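/- **Setting.** Let $d\in\{2,3\}$, $\nu,\mu>0$, $a\ge 0$, let $e_2\in\mathbb R^d$ be a unit vector (opposite to gravity), and let $\hat u_0:\mathbb R^d\to\mathbb C^d$, $\hat\Theta_0:\mathbb R^d\to\mathbb C$, $\hat f:\mathbb R^d\to\mathbb C^d$ be measurable (the Fourier transforms of the initial velocity, initial temperature and time-independent forcing of the Boussinesq equation $u_t-\nu\Delta u=-P[u\cdot\nabla u-ae_2\Theta]+f$, $\Theta_t-\mu\Delta\Theta=-u\cdot\nabla\Theta$). Let $\|\cdot\|_N$ be either $\|\hat g\|_{\gamma,\beta}=\sup_k(1+|k|)^\gamma e^{\beta|k|}|\hat g(k)|$ with $\gamma>d$, $\beta\ge0$, and put $C_0=2^{\gamma+1}\int_{\mathbb R^d}(1+|k|)^{-\gamma}dk$; or $\|\hat g\|_{L^1\cap L^\infty}=\max\{\int|\hat g|\,dk,\ \sup_k|\hat g(k)|\}$, and put $C_0=1$. For pairs, $|\cdot|$ is the Euclidean modulus on $\mathbb C^{d+1}$. Assume $\|(1+|k|)^2(\hat u_0,\hat\Theta_0)\|_N<\infty$ and $\|\hat f\|_N<\infty$.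 Write $P_k=1-k(k\cdot)/|k|^2$, $\hat*$ for convolution in $k$, ${}^*_*$ for convolution in $k$ together with Laplace convolution in $p$, $\mathcal G(z,z')=z'\{-J_1(z)Y_1(z')+Y_1(z)J_1(z')\}$, $z=2|k|\sqrt{\nu p}$, $z'=2|k|\sqrt{\nu p'}$, $\zeta=2|k|\sqrt{\mu p}$, $\zeta'=2|k|\sqrt{\mu p'}$ (at $k=0$ the quotients $\mathcal G(z,z')/z$, $J_1(z)/z$, and likewise with $\zeta$, are replaced by their limits, and $P_0=1$); sum over repeated $j$. Put $$\hat u_1=-\nu|k|^2\hat u_0-ik_jP_k[\hat u_{0,j}\hat*\hat u_0]+aP_k[e_2\hat\Theta_0]+\hat f,\qquad \hat\Theta_1=-\mu|k|^2\hat\Theta_0-ik_j(\hat u_{0,j}\hat*\hat\Theta_0),$$ $$\hat G^{[1]}_j=-P_k[\hat u_{0,j}\hat*\hat H+\hat H_j\hat*\hat u_0+\hat H_j{}^*_*\hat H],\qquad \hat G^{[2]}_j=-[\hat u_{0,j}\hat*\hat S+\hat H_j\hat*\hat\Theta_0+\hat H_j{}^*_*\hat S].$$ Let $(\hat H,\hat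 S)(k,p)$, $p>0$, be measurable with $\|(\hat H,\hat S)(\cdot,p)\|_N$ locally integrable in $p\in[0,\infty)$, and a solution of $$\hat H(k,p)=ik_j\frac{\pi}{z}\int_0^p\mathcal G(z,z')\hat G^{[1]}_j(k,p')\,dp'+a\frac{\pi}{z}\int_0^p\mathcal G(z,z')P_k[e_2\hat S(k,p')]\,dp'+2\hat u_1(k)\frac{J_1(z)}{z},$$ $$\hat S(k,p)=ik_j\frac{\pi}{\zeta}\int_0^p\mathcal G(\zeta,\zeta')\hat G^{[2]}_j(k,p')\,dp'+2\hat\Theta_1(k)\frac{J_1(\zeta)}{\zeta}.$$ Let $p_0>0$. Let $(\hat H,\hat S)^{(a)}$ equal $(\hat H,\hat S)$ for $p\in(0,p_0]$ and $0$ otherwise, let $\hat G^{[1],(a)}_j,\hat G^{[2],(a)}_j$ be $\hat G^{[1]}_j,\hat G^{[2]}_j$ formed with $(\hat H,\hat S)^{(a)}$, and let $(\hat H,\hat S)^{(s)}(k,p)$ be the right-hand sides of the two equations formed with $(\hat H,\hat S)^{(a)}$, where the integrals of $\hat G^{[1],(a)}_j$ and $\hat G^{[2],(a)}_j$ run over $[0,\min(p,2p_0)]$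 and the integral of $\hat S^{(a)}$ over $[0,\min(p,p_0)]$. For $\omega_0\ge0$ define, with values in $[0,\infty]$, $$\mathcal B_0(k)=\pi C_0\sup_{p_0\le p'\le p}\max\left\{\left|\frac{\mathcal G(z,z')}{z}\right|,\left|\frac{\mathcal G(\zeta,\zeta')}{\zeta}\right|\right\},\qquad \mathcal B_3=\sup_k|k|\mathcal B_0(k),\qquad \mathcal B_4=a\sup_k\mathcal B_0(k),$$ $$\mathcal B_1=2\mathcal B_3\|(\hat u_0,\hat\Theta_0)\|_N,\qquad \mathcal B_2(p)=2\mathcal B_3\|(\hat H,\hat S)^{(a)}(\cdot,p)\|_N,$$ $$b=\omega_0\int_{p_0}^\infty e^{-\omega_0p}\|(\hat H,\hat S)^{(s)}(\cdot,p)\|_N\,dp,\qquad \epsilon_1=\mathcal B_1+\mathcal B_4+\int_0^{p_0}e^{-\omega_0p}\mathcal B_2(p)\,dp .$$ **Theorem (Improved exponential estimates).** For every $\omega\ge\omega_0$ with $\omega>\epsilon_1+2\sqrt{\mathcal B_3b}$, and such that $\omega=\omega_0$ or $\omega_0p_0\ge1$, $$\int_0^\infty e^{-\omega p}\,\|(\hat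 H,\hat S)(\cdot,p)\|_N\,dp<\infty .$$ -/

import Mathlib

open MeasureTheory Set
open scoped ENNReal

noncomputable section

namespace Boussinesq

/-- Wave vectors `k ∈ ℝ^d`, with the Euclidean norm. -/
abbrev Wave (d : ℕ) := EuclideanSpace ℝ (Fin d)

/-- Values of Fourier transforms of vector fields: `ℂ^d`, with the Hermitian norm. -/
abbrev CVec (d : ℕ) := EuclideanSpace ℂ (Fin d)

/-! ### Bessel functions of order one -/

/-- The Bessel function of the first kind `J₁`. -/
def besselJ1 (x : ℝ) : ℝ :=
  ∑' m : ℕ, (-1 : ℝ) ^ m / ((m.factorial : ℝ) * ((m + 1).factorial : ℝ)) * (x / 2) ^ (2 * m + 1)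

/-- The Bessel function of the second kind `Y₁` on `(0, ∞)`, by its standard expansion; here
`ψ(m+1) + ψ(m+2) = H_m + H_{m+1} - 2γ`, with `ψ` the digamma function, `H_m` the harmonic numbers
and `γ` the Euler–Mascheroni constant. -/
def besselY1 (x : ℝ) : ℝ :=
  -2 / (Real.pi * x) + 2 / Real.pi * Real.log (x / 2) * besselJ1 x
    - 1 / Real.pi * ∑' m : ℕ,
        ((harmonic m : ℝ) + (harmonic (m + 1) : ℝ) - 2 * Real.eulerMascheroniConstant)
          * ((-1 : ℝ) ^ m / ((m.factorial : ℝ) * ((m + 1).factorial : ℝ)))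
          * (x / 2) ^ (2 * m + 1)

/-- `𝒢(z, z') = z' (-J₁(z) Y₁(z') + Y₁(z) J₁(z'))`. -/
def kernelG (z z' : ℝ) : ℝ :=
  z' * (-besselJ1 z * besselY1 z' + besselY1 z * besselJ1 z')

/-- `z = 2 |k| √(κ p)`, for a diffusivity `κ` (which is `ν` or `μ`). -/
def zVar {d : ℕ} (κ : ℝ) (k : Wave d) (p : ℝ) : ℝ := 2 * ‖k‖ * Real.sqrt (κ * p)

/-- The kernel `π 𝒢(z, z') / z` with `z = 2|k|√(κp)`, `z' = 2|k|√(κp')`. At `k = 0` the formula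
reads `0/0`, and the value is the limit as `k → 0`, which is `1 - p'/p`. -/
def borelKernel {d : ℕ} (κ : ℝ) (k : Wave d) (p p' : ℝ) : ℝ :=
  if k = 0 then 1 - p' / p
  else Real.pi * kernelG (zVar κ k p) (zVar κ k p') / zVar κ k p

/-- `2 J₁(z) / z` with `z = 2|k|√(κp)`, extended by its limit `1` at `k = 0`. -/
def borelSource {d : ℕ} (κ : ℝ) (k : Wave d) (p : ℝ) : ℝ :=
  if k = 0 then 1 else 2 * besselJ1 (zVar κ k p) / zVar κ k p

/-! ### Norms in the wave vector -/

/-- The two choices for the norm `‖·‖_N`: the weighted norm `‖·‖_{γ,β}` or the norm of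
`L¹ ∩ L^∞`. -/
inductive FourierNorm where
  | weighted (γ β : ℝ)
  | l1linf

/-- The standing assumptions `γ > d`, `β ≥ 0` on the weights. -/
def FourierNorm.Admissible (d : ℕ) : FourierNorm → Prop
  | .weighted γ β => (d : ℝ) < γ ∧ 0 ≤ β
  | .l1linf => True

/-- `‖g‖_N ∈ [0, ∞]` of a function of `k`, given through its modulus `g`. -/
def FourierNorm.nrm {d : ℕ} (N : FourierNorm) (g : Wave d → ℝ) : ℝ≥0∞ :=
  match N with
  | .weighted γ β =>
      ⨆ k : Wave d, ENNReal.ofReal ((1 + ‖k‖) ^ γ * Real.exp (β * ‖k‖)) * ‖g k‖ₑ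
  | .l1linf => max (∫⁻ k : Wave d, ‖g k‖ₑ) (⨆ k : Wave d, ‖g k‖ₑ)

/-- The constant `C₀` of the algebra property `‖v̂ * ŵ‖_N ≤ C₀ ‖v̂‖_N ‖ŵ‖_N`:
`2^{γ+1} ∫ (1+|k|)^{-γ} dk` for the weighted norm, and `1` for `L¹ ∩ L^∞`. -/
def FourierNorm.C0 (d : ℕ) : FourierNorm → ℝ≥0∞
  | .weighted γ _ =>
      ENNReal.ofReal (2 ^ (γ + 1)) * ∫⁻ k : Wave d, ENNReal.ofReal ((1 + ‖k‖) ^ (-γ))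
  | .l1linf => 1

/-- The Euclidean modulus `|(v, s)|` of a pair in `ℂ^d × ℂ`. -/
def pairAbs {d : ℕ} (v : CVec d) (s : ℂ) : ℝ := Real.sqrt (‖v‖ ^ 2 + ‖s‖ ^ 2)

/-! ### Fourier and Laplace convolutions, the Hodge projection -/

section Convolutions

variable {d : ℕ} {V : Type*} [NormedAddCommGroup V] [NormedSpace ℂ V]

/-- The Fourier convolution `(f * g)(k) = ∫ f(q) g(k - q) dq`. -/
def fourierConv (f : Wave d → ℂ) (g : Wave d → V) (k : Wave d) : V :=
  ∫ q : Wave d, f q • g (k - q)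

/-- The convolution in both variables: Fourier in `k`, Laplace in `p`. -/
def fourierLaplaceConv (F : Wave d → ℝ → ℂ) (G : Wave d → ℝ → V) (k : Wave d) (p : ℝ) : V :=
  ∫ s in (0 : ℝ)..p, fourierConv (fun q => F q s) (fun q => G q (p - s)) k

end Convolutions

/-- The Fourier symbol `P_k v = v - k (k·v)/|k|²` of the Hodge projection (`P_0 v = v`). -/
def hodge {d : ℕ} (k : Wave d) (v : CVec d) : CVec d :=
  WithLp.toLp 2 fun i => v i - (k i : ℂ) * (∑ j, (k j : ℂ) * v j) / ((‖k‖ ^ 2 : ℝ) : ℂ)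

/-- The vector `s e`, for a real vector `e` and a complex number `s`. -/
def scaleVec {d : ℕ} (e : Wave d) (s : ℂ) : CVec d :=
  WithLp.toLp 2 fun i => (e i : ℂ) * s

/-! ### The integral equations in the Borel plane -/

/-- Parameters and data of the Boussinesq equation on the Fourier side: viscosity `ν`, thermal
diffusivity `μ`, buoyancy parameter `a`, the direction `e` opposite to gravity, and the Fourier
transforms of the initial velocity, initial temperature and time-independent forcing. -/
structure Data (d : ℕ) where
  ν : ℝ
  μ : ℝ
  a : ℝ
  e : Wave d
  u0 : Wave d → CVec d
  Θ0 : Wave d → ℂ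
  f : Wave d → CVec d

section Equations

variable {d : ℕ} (D : Data d)

/-- `û₁ = -ν|k|² û₀ - i k_j P_k[û_{0,j} * û₀] + a P_k[e Θ̂₀] + f̂`. -/
def u1 (k : Wave d) : CVec d :=
  -((D.ν * ‖k‖ ^ 2 : ℝ) : ℂ) • D.u0 k
    - ∑ j, (Complex.I * (k j : ℂ)) • hodge k (fourierConv (fun q => D.u0 q j) D.u0 k)
    + (D.a : ℂ) • hodge k (scaleVec D.e (D.Θ0 k)) + D.f k

/-- `Θ̂₁ = -μ|k|² Θ̂₀ - i k_j (û_{0,j} * Θ̂₀)`. -/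
def Θ1 (k : Wave d) : ℂ :=
  -((D.μ * ‖k‖ ^ 2 : ℝ) : ℂ) * D.Θ0 k
    - ∑ j, (Complex.I * (k j : ℂ)) * fourierConv (fun q => D.u0 q j) D.Θ0 k

/-- `Ĝ_j^{[1]} = -P_k[û_{0,j} * Ĥ + Ĥ_j * û₀ + Ĥ_j ** Ĥ]`. -/
def G1 (H : Wave d → ℝ → CVec d) (j : Fin d) (k : Wave d) (p : ℝ) : CVec d :=
  -hodge k (fourierConv (fun q => D.u0 q j) (fun q => H q p) k
    + fourierConv (fun q => H q p j) D.u0 k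
    + fourierLaplaceConv (fun q s => H q s j) H k p)

/-- `Ĝ_j^{[2]} = -[û_{0,j} * Ŝ + Ĥ_j * Θ̂₀ + Ĥ_j ** Ŝ]`. -/
def G2 (H : Wave d → ℝ → CVec d) (S : Wave d → ℝ → ℂ) (j : Fin d) (k : Wave d) (p : ℝ) : ℂ :=
  -(fourierConv (fun q => D.u0 q j) (fun q => S q p) k
    + fourierConv (fun q => H q p j) D.Θ0 k
    + fourierLaplaceConv (fun q s => H q s j) S k p)

/-- The velocity component
`i k_j (π/z) ∫_0^{L₁} 𝒢(z,z') Ĝ_j^{[1]} dp' + a (π/z) ∫_0^{L₂} 𝒢(z,z') P_k[e Ŝ] dp' + 2 û₁ J₁(z)/z`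
with upper limits of integration `L₁`, `L₂`. -/
def velocityRHS (H : Wave d → ℝ → CVec d) (S : Wave d → ℝ → ℂ) (L₁ L₂ : ℝ)
    (k : Wave d) (p : ℝ) : CVec d :=
  (∑ j, (Complex.I * (k j : ℂ)) •
      ∫ p' in (0 : ℝ)..L₁, (borelKernel D.ν k p p' : ℂ) • G1 D H j k p')
    + (D.a : ℂ) •
      (∫ p' in (0 : ℝ)..L₂, (borelKernel D.ν k p p' : ℂ) • hodge k (scaleVec D.e (S k p')))
    + (borelSource D.ν k p : ℂ) • u1 D k

/-- The temperature component
`i k_j (π/ζ) ∫_0^{L₁} 𝒢(ζ,ζ') Ĝ_j^{[2]} dp' + 2 Θ̂₁ J₁(ζ)/ζ` with upper limit `L₁`. -/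
def temperatureRHS (H : Wave d → ℝ → CVec d) (S : Wave d → ℝ → ℂ) (L₁ : ℝ)
    (k : Wave d) (p : ℝ) : ℂ :=
  (∑ j, (Complex.I * (k j : ℂ)) *
      ∫ p' in (0 : ℝ)..L₁, (borelKernel D.μ k p p' : ℂ) * G2 D H S j k p')
    + (borelSource D.μ k p : ℂ) * Θ1 D k

/-- `(Ĥ, Ŝ)` solves the system of integral equations `(Ĥ, Ŝ) = 𝒩[(Ĥ, Ŝ)]` for `p ∈ (0, ∞)`, in
the class of functions for which `‖(Ĥ, Ŝ)(·, p)‖_N` is locally integrable on `[0, ∞)`. -/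
structure IsSolution (N : FourierNorm) (H : Wave d → ℝ → CVec d) (S : Wave d → ℝ → ℂ) :
    Prop where
  measurable_H : Measurable fun x : Wave d × ℝ => H x.1 x.2
  measurable_S : Measurable fun x : Wave d × ℝ => S x.1 x.2
  aemeasurable_norm :
    AEMeasurable (fun p => N.nrm fun k => pairAbs (H k p) (S k p)) (volume.restrict (Ioi 0))
  locallyIntegrable : ∀ L : ℝ,
    ∫⁻ p in Ioc 0 L, N.nrm (fun k => pairAbs (H k p) (S k p)) < ∞
  velocity_eq : ∀ᵐ p ∂(volume.restrict (Ioi (0 : ℝ))), ∀ k, H k p = velocityRHS D H S p p k p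
  temperature_eq : ∀ᵐ p ∂(volume.restrict (Ioi (0 : ℝ))), ∀ k, S k p = temperatureRHS D H S p k p

end Equations

/-! ### The functionals of the solution on `(0, p₀]` -/

/-- The known part `F^{(a)}`: equal to `F` for `p ∈ (0, p₀]` and to `0` otherwise. -/
def known {d : ℕ} {V : Type*} [Zero V] (p₀ : ℝ) (F : Wave d → ℝ → V) : Wave d → ℝ → V :=
  fun k => (Ioc 0 p₀).indicator (F k)

section Functionals

variable {d : ℕ} (N : FourierNorm) (D : Data d) (H : Wave d → ℝ → CVec d) (S : Wave d → ℝ → ℂ)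
  (p₀ : ℝ)

/-- `Ĥ^{(s)}`. -/
def Hs (k : Wave d) (p : ℝ) : CVec d :=
  velocityRHS D (known p₀ H) (known p₀ S) (min p (2 * p₀)) (min p p₀) k p

/-- `Ŝ^{(s)}`. -/
def Ss (k : Wave d) (p : ℝ) : ℂ :=
  temperatureRHS D (known p₀ H) (known p₀ S) (min p (2 * p₀)) k p

/-- `b = ω₀ ∫_{p₀}^∞ e^{-ω₀ p} ‖(Ĥ, Ŝ)^{(s)}(·, p)‖_N dp`. -/
def b (ω₀ : ℝ) : ℝ≥0∞ :=
  ENNReal.ofReal ω₀ * ∫⁻ p in Ioi p₀, ENNReal.ofReal (Real.exp (-ω₀ * p)) *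
    N.nrm fun k => pairAbs (Hs D H S p₀ k p) (Ss D H S p₀ k p)

/-- `ℬ₀(k) = C₀ sup_{p₀ ≤ p' ≤ p} π max(|𝒢(z,z')/z|, |𝒢(ζ,ζ')/ζ|)`. -/
def B0 (k : Wave d) : ℝ≥0∞ :=
  N.C0 d * ⨆ (p' : ℝ) (p : ℝ) (_ : p₀ ≤ p' ∧ p' ≤ p),
    max ‖borelKernel D.ν k p p'‖ₑ ‖borelKernel D.μ k p p'‖ₑ

/-- `ℬ₃ = sup_k |k| ℬ₀(k)`. -/
def B3 : ℝ≥0∞ := ⨆ k : Wave d, ‖k‖ₑ * B0 N D p₀ k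

/-- `ℬ₁ = 2 sup_k |k| ℬ₀(k) ‖(û₀, Θ̂₀)‖_N`. -/
def B1 : ℝ≥0∞ :=
  2 * (⨆ k : Wave d, ‖k‖ₑ * B0 N D p₀ k) * N.nrm fun k => pairAbs (D.u0 k) (D.Θ0 k)

/-- `ℬ₂(p) = 2 sup_k |k| ℬ₀(k) ‖(Ĥ, Ŝ)^{(a)}(·, p)‖_N`. -/
def B2 (p : ℝ) : ℝ≥0∞ :=
  2 * (⨆ k : Wave d, ‖k‖ₑ * B0 N D p₀ k) *
    N.nrm fun k => pairAbs (known p₀ H k p) (known p₀ S k p)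

/-- `ℬ₄ = a sup_k ℬ₀(k)`. -/
def B4 : ℝ≥0∞ := ENNReal.ofReal D.a * ⨆ k : Wave d, B0 N D p₀ k

/-- `ε₁ = ℬ₁ + ℬ₄ + ∫_0^{p₀} e^{-ω₀ p} ℬ₂(p) dp`. -/
def ε₁ (ω₀ : ℝ) : ℝ≥0∞ :=
  B1 N D p₀ + B4 N D p₀ +
    ∫⁻ p in Ioc 0 p₀, ENNReal.ofReal (Real.exp (-ω₀ * p)) * B2 N D H S p₀ p

end Functionals

end Boussinesq

end

/-! Truncate the solution at `p₀` and compare. For `p > p₀`, subtracting the equation for `(Ĥ,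
Ŝ)^{(s)}` from the equation for `(Ĥ, Ŝ)` cancels the source terms and leaves integrals of the kernel
against differences of the nonlinear and buoyancy terms. By causality of the Laplace convolution
these differences vanish for `p' ≤ p₀`, so only kernel values with `p₀ ≤ p' ≤ p` enter, which
`kernelSup` controls. Every product in the difference has a factor at a time beyond `p₀`.

Write `h` for the norm of the solution, `g` for its part on `(0, p₀]` and `f` for its part on `(p₀,
∞)`. Taking norms and using the algebra property `enrm_conv_le` gives
(`IsMajorant.ae_le_add_volterra`) `h(p) ≤ hs(p) + ∫_{p₀}^p [(ℬ₁ + ℬ₄) f + ℬ₃ (g*f + f*g + f*f)]`.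
Multiply by `ω e^{-ωp}` and integrate: the factor `ω` absorbs the outer integration and convolutions
become products. With `X(L) = ∫_{p₀}^L e^{-ωp} h`, this yields `ω X ≤ b + ε₁ X + ℬ₃ X²`. The
hypothesis on `ω` is positivity of the discriminant, so the continuous function `X`, which starts
from `0`, can never cross the gap between the two roots. It is therefore bounded uniformly in `L`
(`lintegral_expWeight_lt_top_of_volterra`).

Two facts about Bessel functions are needed: `0 < ℬ₃ < ∞`. In the variable `x = κ|k|²p` the kernel
is `D(x, x')/x`, where `D` solves `f'' = -f/x` with zero value and Wronskian slope at `x'`. The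
energy `f'² + f²/x` decreases, so `|D| ≤ |W| √x` and `|k|` times the kernel is bounded for `p ≥ p₀`.
Positivity holds because the two solutions behave differently at the origin
(`exists_fundSol_ne_zero`).

All estimates are made in `[0, ∞]`; integrability is established only where signed integrals are
subtracted or moved inside a modulus. -/

namespace Boussinesq

/-! ### Everywhere convergent real power series -/

/-- The coefficients of an everywhere convergent power series. -/
def EntireCoeff (c : ℕ → ℝ) : Prop := ∀ r : ℝ, Summable fun n => ‖c n * r ^ n‖

/-- The sum of a power series. -/
noncomputable def powerSum (c : ℕ → ℝ) (x : ℝ) : ℝ := ∑' n, c n * x ^ n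

/-- The coefficients of the derivative of a power series. -/
def derivCoeff (c : ℕ → ℝ) (n : ℕ) : ℝ := (n + 1) * c (n + 1)

theorem EntireCoeff.hasSum {c : ℕ → ℝ} (hc : EntireCoeff c) (x : ℝ) :
    HasSum (fun n => c n * x ^ n) (powerSum c x) :=
  (hc x).of_norm.hasSum

/-- Since `n ≤ 2^n`, the differentiated series at `r` is dominated by the original series at `2r`.
-/
theorem EntireCoeff.summable_nat_mul {c : ℕ → ℝ} (hc : EntireCoeff c) {r : ℝ} (hr : 0 < r) :
    Summable fun n : ℕ => ‖c n‖ * (n * r ^ (n - 1)) := by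
  have h := (hc (2 * r)).mul_left (1 / r)
  refine Summable.of_nonneg_of_le (fun n => by positivity) (fun n => ?_) h
  rw [norm_mul, norm_pow, Real.norm_of_nonneg (by positivity : 0 ≤ 2 * r), mul_pow]
  have h2 : (n : ℝ) ≤ 2 ^ n := by exact_mod_cast n.lt_two_pow_self.le
  rcases n with _ | n
  · simp; positivity
  · rw [Nat.add_sub_cancel]
    have : 1 / r * (‖c (n + 1)‖ * (2 ^ (n + 1) * r ^ (n + 1)))
        = ‖c (n + 1)‖ * (2 ^ (n + 1) * r ^ n) := by
      rw [pow_succ r]; field_simp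
    rw [this]
    gcongr

theorem EntireCoeff.deriv {c : ℕ → ℝ} (hc : EntireCoeff c) : EntireCoeff (derivCoeff c) := by
  intro r
  have h := (summable_nat_add_iff 1).2 (hc.summable_nat_mul (r := |r| + 1) (by positivity))
  refine Summable.of_nonneg_of_le (fun n => by positivity) (fun n => ?_) h
  rw [derivCoeff, norm_mul, norm_mul, norm_pow, Nat.add_sub_cancel]
  have h1 : ‖(n : ℝ) + 1‖ = ((n + 1 : ℕ) : ℝ) := by
    rw [Real.norm_of_nonneg (by positivity)]; push_cast; rfl
  rw [h1, mul_comm (((n + 1 : ℕ) : ℝ)), mul_assoc]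
  have : ‖r‖ ≤ |r| + 1 := by rw [Real.norm_eq_abs]; linarith
  gcongr

theorem EntireCoeff.hasDerivAt {c : ℕ → ℝ} (hc : EntireCoeff c) (x : ℝ) :
    HasDerivAt (powerSum c) (powerSum (derivCoeff c) x) x := by
  have hR : 0 < |x| + 1 := by positivity
  have hmem : x ∈ Metric.ball (0 : ℝ) (|x| + 1) := by simp
  have key := hasDerivAt_tsum_of_isPreconnected (g := fun (n : ℕ) (y : ℝ) => c n * y ^ n)
    (g' := fun (n : ℕ) (y : ℝ) => c n * (n * y ^ (n - 1)))
    (hc.summable_nat_mul hR) Metric.isOpen_ball (convex_ball (0 : ℝ) (|x| + 1)).isPreconnected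
    (fun n y _ => (hasDerivAt_pow n y).const_mul (c n))
    (fun n y hy => by
      rw [norm_mul, norm_mul, norm_pow, Real.norm_natCast]
      have : ‖y‖ ≤ |x| + 1 := by simpa using (mem_ball_zero_iff.1 hy).le
      gcongr) hmem (hc x).of_norm hmem
  have hs : Summable fun n : ℕ => c n * (n * x ^ (n - 1)) := by
    refine Summable.of_norm_bounded (hc.summable_nat_mul hR) fun n => ?_
    rw [norm_mul, norm_mul, norm_pow, Real.norm_natCast]
    have : ‖x‖ ≤ |x| + 1 := by rw [Real.norm_eq_abs]; linarith
    gcongr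
  have e : powerSum (derivCoeff c) x = ∑' n : ℕ, c n * (n * x ^ (n - 1)) := by
    rw [hs.tsum_eq_zero_add]
    simp only [powerSum, derivCoeff, Nat.add_sub_cancel]
    push_cast
    simp only [zero_mul, mul_zero, zero_add]
    exact tsum_congr fun n => by ring
  rw [e]
  exact key

theorem hasSum_of_eq {f g : ℕ → ℝ} {a : ℝ} (h : HasSum f a) (e : ∀ n, g n = f n) :
    HasSum g a := by
  rwa [funext e]

theorem powerSum_zero (c : ℕ → ℝ) : powerSum c 0 = c 0 := by
  rw [powerSum, tsum_eq_single 0]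
  · simp
  · intro n hn; simp [hn]

/-- `x f(x)` as a power series, for the derivative `f` of a power series. -/
theorem EntireCoeff.hasSum_mul_deriv {c : ℕ → ℝ} (hc : EntireCoeff c) (x : ℝ) :
    HasSum (fun n : ℕ => n * c n * x ^ n) (x * powerSum (derivCoeff c) x) := by
  rw [← hasSum_nat_add_iff' 1]
  simp only [Finset.range_one, Finset.sum_singleton, Nat.cast_zero, zero_mul, sub_zero]
  refine hasSum_of_eq ((hc.deriv.hasSum x).mul_left x) fun n => ?_
  simp only [derivCoeff]; push_cast; ring

/-! ### The Bessel functions as power series -/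

/-- The coefficients of `J₁(2√x)/√x`. -/
noncomputable def coeffJ (m : ℕ) : ℝ :=
  (-1 : ℝ) ^ m / ((m.factorial : ℝ) * ((m + 1).factorial : ℝ))

/-- The coefficients of the regular series in the expansion of `Y₁`. -/
noncomputable def coeffY (m : ℕ) : ℝ :=
  ((harmonic m : ℝ) + (harmonic (m + 1) : ℝ) - 2 * Real.eulerMascheroniConstant) * coeffJ m

theorem norm_coeffJ_le (m : ℕ) : ‖coeffJ m‖ ≤ 1 / (m.factorial : ℝ) := by
  rw [coeffJ, norm_div, norm_pow, norm_neg, norm_one, one_pow]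
  have h1 : (1 : ℝ) ≤ ((m + 1).factorial : ℝ) := by exact_mod_cast Nat.factorial_pos _
  have h2 : (0 : ℝ) < (m.factorial : ℝ) := by exact_mod_cast Nat.factorial_pos _
  rw [Real.norm_of_nonneg (by positivity)]
  gcongr
  nlinarith

theorem harmonic_nonneg_le (m : ℕ) : 0 ≤ (harmonic m : ℝ) ∧ (harmonic m : ℝ) ≤ m := by
  induction m with
  | zero => simp
  | succ n ih =>
    rw [harmonic_succ]
    push_cast
    have : ((n : ℝ) + 1)⁻¹ ≤ 1 := inv_le_one_of_one_le₀ (by linarith [n.cast_nonneg (α := ℝ)])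
    have : 0 ≤ ((n : ℝ) + 1)⁻¹ := by positivity
    constructor <;> linarith [ih.1, ih.2]

theorem norm_coeffY_le (m : ℕ) : ‖coeffY m‖ ≤ 4 * 2 ^ m * (1 / (m.factorial : ℝ)) := by
  rw [coeffY, norm_mul]
  have h0 := harmonic_nonneg_le m
  have h1 := harmonic_nonneg_le (m + 1)
  have h2 := Real.eulerMascheroniConstant_lt_two_thirds
  have h3 := Real.one_half_lt_eulerMascheroniConstant
  have h4 : (m : ℝ) + 1 ≤ 2 ^ m := by exact_mod_cast m.lt_two_pow_self
  have h5 := h1.2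
  push_cast at h5
  gcongr
  · rw [Real.norm_eq_abs, abs_le]
    constructor <;> linarith [h0.1, h1.1, h0.2]
  · exact norm_coeffJ_le m

theorem entireCoeff_of_le {c : ℕ → ℝ} (hc : ∀ m, ‖c m‖ ≤ 4 * 2 ^ m * (1 / (m.factorial : ℝ))) :
    EntireCoeff c := by
  intro r
  refine Summable.of_nonneg_of_le (fun n => by positivity) (fun n => ?_)
    ((Real.summable_pow_div_factorial (2 * |r|)).mul_left 4)
  rw [norm_mul, norm_pow, Real.norm_eq_abs r]
  calc ‖c n‖ * |r| ^ n ≤ 4 * 2 ^ n * (1 / (n.factorial : ℝ)) * |r| ^ n := by gcongr; exact hc n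
    _ = _ := by rw [mul_pow]; ring

theorem entireCoeff_coeffJ : EntireCoeff coeffJ := by
  refine entireCoeff_of_le fun m => (norm_coeffJ_le m).trans ?_
  refine le_mul_of_one_le_left (by positivity) ?_
  have : (1 : ℝ) ≤ 2 ^ m := one_le_pow₀ (by norm_num)
  linarith

theorem entireCoeff_coeffY : EntireCoeff coeffY := entireCoeff_of_le norm_coeffY_le

theorem coeffJ_succ (n : ℕ) : ((n : ℝ) + 1) * (n + 2) * coeffJ (n + 1) = -coeffJ n := by
  have h2 : (n.factorial : ℝ) ≠ 0 := by exact_mod_cast Nat.factorial_ne_zero _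
  simp only [coeffJ, Nat.factorial_succ]
  push_cast
  have h3 : (n : ℝ) + 1 ≠ 0 := by positivity
  have h4 : (n : ℝ) + 1 + 1 ≠ 0 := by positivity
  field_simp
  ring

/-- The extra term comes from the increments of the harmonic numbers: `(n+1)(n+2) (1/(n+1) +
1/(n+2)) = 2n + 3`. -/
theorem coeffY_succ (n : ℕ) :
    ((n : ℝ) + 1) * (n + 2) * coeffY (n + 1) = -coeffY n + (2 * n + 3) * coeffJ (n + 1) := by
  have h3 : (n : ℝ) + 1 ≠ 0 := by positivity
  have h4 : (n : ℝ) + 1 + 1 ≠ 0 := by positivity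
  have e := coeffJ_succ n
  have e' : coeffJ n = -(((n : ℝ) + 1) * (n + 2) * coeffJ (n + 1)) := by linarith
  simp only [coeffY, harmonic_succ, e']
  push_cast
  field_simp
  ring

/-- `Σ (-1)^m x^m / (m! (m+1)!)`. -/
noncomputable def seriesJ : ℝ → ℝ := powerSum coeffJ

/-- The regular series of `Y₁`. -/
noncomputable def seriesY : ℝ → ℝ := powerSum coeffY

theorem seriesJ_ode (x : ℝ) :
    x * powerSum (derivCoeff (derivCoeff coeffJ)) x + 2 * powerSum (derivCoeff coeffJ) x
      + seriesJ x = 0 := by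
  have h1 := entireCoeff_coeffJ.deriv.hasSum_mul_deriv x
  have h2 := (entireCoeff_coeffJ.deriv.hasSum x).mul_left 2
  have h3 := entireCoeff_coeffJ.hasSum x
  refine ((h1.add h2).add h3).unique ?_
  refine hasSum_of_eq (hasSum_zero : HasSum (fun _ : ℕ => (0 : ℝ)) 0) fun n => ?_
  have := coeffJ_succ n
  simp only [derivCoeff]
  linear_combination x ^ n * this

/-- The right side is what the logarithm in the second Frobenius solution produces, up to sign.
Multiplication by `x` shifts the recursion `coeffY_succ` by one index; the constant term is matched
by `-1`, because `coeffJ 0 = 1`. -/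
theorem seriesY_ode (x : ℝ) :
    x * (x * powerSum (derivCoeff (derivCoeff coeffY)) x + 2 * powerSum (derivCoeff coeffY) x
      + seriesY x) = 2 * x * powerSum (derivCoeff coeffJ) x + seriesJ x - 1 := by
  have h1 := entireCoeff_coeffY.deriv.hasSum_mul_deriv x
  have h2 := (entireCoeff_coeffY.deriv.hasSum x).mul_left 2
  have h3 := entireCoeff_coeffY.hasSum x
  have h4 := ((h1.add h2).add h3).mul_left x
  have h5 := (entireCoeff_coeffJ.hasSum_mul_deriv x).mul_left 2
  have h6 := h5.add (entireCoeff_coeffJ.hasSum x)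
  rw [← hasSum_nat_add_iff' 1] at h6
  simp only [Finset.range_one, Finset.sum_singleton] at h6
  have h7 : coeffJ 0 = 1 := by simp [coeffJ]
  rw [h7] at h6
  have h8 := h4.unique (hasSum_of_eq h6 fun n => by
    have := coeffY_succ n
    simp only [derivCoeff]
    push_cast
    linear_combination x ^ (n + 1) * this)
  rw [seriesY, h8, seriesJ]
  simp
  ring

/-! ### The two Frobenius solutions of `f'' = -f / x` -/

/-- The solution `√x J₁(2√x)` of `f'' = -f / x`. -/
noncomputable def solJ (x : ℝ) : ℝ := x * seriesJ x

/-- The solution `π √x Y₁(2√x)` of `f'' = -f / x`. -/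
noncomputable def solY (x : ℝ) : ℝ := -1 + Real.log x * solJ x - x * seriesY x

/-- The derivative of `solJ`. -/
noncomputable def solJ' (x : ℝ) : ℝ := seriesJ x + x * powerSum (derivCoeff coeffJ) x

/-- The derivative of `solY`. -/
noncomputable def solY' (x : ℝ) : ℝ :=
  seriesJ x + Real.log x * solJ' x - (seriesY x + x * powerSum (derivCoeff coeffY) x)

theorem hasDerivAt_solJ (x : ℝ) : HasDerivAt solJ (solJ' x) x := by
  have h := (hasDerivAt_id x).mul (entireCoeff_coeffJ.hasDerivAt x)
  exact h.congr_deriv (by simp [solJ', seriesJ])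

theorem hasDerivAt_solJ' {x : ℝ} (hx : 0 < x) : HasDerivAt solJ' (-solJ x / x) x := by
  have h := (entireCoeff_coeffJ.hasDerivAt x).add
    ((hasDerivAt_id x).mul (entireCoeff_coeffJ.deriv.hasDerivAt x))
  refine h.congr_deriv ?_
  have := seriesJ_ode x
  simp only [solJ, id]
  field_simp
  linarith

theorem hasDerivAt_solY {x : ℝ} (hx : 0 < x) : HasDerivAt solY (solY' x) x := by
  have h := (((Real.hasDerivAt_log hx.ne').mul (hasDerivAt_solJ x)).const_add (-1)).sub
    ((hasDerivAt_id x).mul (entireCoeff_coeffY.hasDerivAt x))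
  refine h.congr_deriv ?_
  simp only [solY', solJ, id, seriesY]
  field_simp

theorem hasDerivAt_solY' {x : ℝ} (hx : 0 < x) : HasDerivAt solY' (-solY x / x) x := by
  have h := ((entireCoeff_coeffJ.hasDerivAt x).add
    ((Real.hasDerivAt_log hx.ne').mul (hasDerivAt_solJ' hx))).sub
    ((entireCoeff_coeffY.hasDerivAt x).add
      ((hasDerivAt_id x).mul (entireCoeff_coeffY.deriv.hasDerivAt x)))
  refine h.congr_deriv ?_
  have := seriesY_ode x
  simp only [solY, solJ, solJ', id]
  field_simp
  linarith

theorem besselJ1_two_mul {s : ℝ} (hs : 0 < s) : besselJ1 (2 * s) = solJ (s ^ 2) / s := by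
  rw [besselJ1, solJ, seriesJ, powerSum]
  have : s ^ 2 * (∑' n, coeffJ n * (s ^ 2) ^ n) / s = s * ∑' n, coeffJ n * (s ^ 2) ^ n := by
    field_simp
  rw [this, ← tsum_mul_left]
  refine tsum_congr fun n => ?_
  rw [coeffJ, mul_div_cancel_left₀ _ (two_ne_zero), ← pow_mul]
  ring

theorem besselY1_two_mul {s : ℝ} (hs : 0 < s) :
    besselY1 (2 * s) = solY (s ^ 2) / (Real.pi * s) := by
  rw [besselY1, besselJ1_two_mul hs, mul_div_cancel_left₀ _ (two_ne_zero), solY, Real.log_pow]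
  have : ∑' m : ℕ, ((harmonic m : ℝ) + (harmonic (m + 1) : ℝ)
      - 2 * Real.eulerMascheroniConstant) * ((-1 : ℝ) ^ m / ((m.factorial : ℝ) *
        ((m + 1).factorial : ℝ))) * s ^ (2 * m + 1) = s * seriesY (s ^ 2) := by
    rw [seriesY, powerSum, ← tsum_mul_left]
    refine tsum_congr fun n => ?_
    rw [coeffY, coeffJ, ← pow_mul]
    ring
  rw [this]
  have := Real.pi_pos
  push_cast
  field_simp

/-- The fundamental solution `D(x, x')` of `f'' = -f / x`, up to normalization. -/
noncomputable def fundSol (x x' : ℝ) : ℝ := solY x * solJ x' - solJ x * solY x'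

theorem borelKernel_eq {d : ℕ} {κ : ℝ} (hκ : 0 < κ) {k : Wave d} (hk : k ≠ 0) {p p' : ℝ}
    (hp : 0 < p) (hp' : 0 < p') :
    borelKernel κ k p p' = fundSol (κ * ‖k‖ ^ 2 * p) (κ * ‖k‖ ^ 2 * p') / (κ * ‖k‖ ^ 2 * p) := by
  have hk' : 0 < ‖k‖ := norm_pos_iff.2 hk
  have key : ∀ q : ℝ, 0 < q → (‖k‖ * √(κ * q)) ^ 2 = κ * ‖k‖ ^ 2 * q := fun q hq => by
    rw [mul_pow, Real.sq_sqrt (by positivity)]; ring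
  have hs : 0 < ‖k‖ * √(κ * p) := by positivity
  have hs' : 0 < ‖k‖ * √(κ * p') := by positivity
  rw [borelKernel, if_neg hk, kernelG, zVar, zVar, mul_assoc 2 ‖k‖, mul_assoc 2 ‖k‖,
    besselJ1_two_mul hs, besselJ1_two_mul hs', besselY1_two_mul hs, besselY1_two_mul hs',
    key p hp, key p' hp', fundSol, ← key p hp]
  generalize ‖k‖ * √(κ * p) = s at *
  generalize ‖k‖ * √(κ * p') = s' at *
  have := Real.pi_pos
  field_simp
  ring

/-! ### Bounds by the energy method -/

/-- The Wronskian of `solJ` and `solY`. -/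
noncomputable def wronskian (x : ℝ) : ℝ := solY' x * solJ x - solJ' x * solY x

/-- The equation has no first-order term, so the Wronskian is constant. Only this constancy is used
later, never its value. -/
theorem wronskian_eq {x : ℝ} (hx : 0 < x) : wronskian x = wronskian 1 := by
  have hd : ∀ y ∈ Ioi (0 : ℝ), HasDerivAt wronskian 0 y := fun y hy => by
    have h := ((hasDerivAt_solY' hy).mul (hasDerivAt_solJ y)).sub
      ((hasDerivAt_solJ' hy).mul (hasDerivAt_solY hy))
    exact h.congr_deriv (by ring)
  exact isOpen_Ioi.is_const_of_deriv_eq_zero (convex_Ioi 0).isPreconnected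
    (fun y hy => (hd y hy).differentiableAt.differentiableWithinAt)
    (fun y hy => (hd y hy).deriv) hx (mem_Ioi.2 one_pos)

/-- The derivative of `fundSol` in its first argument. -/
noncomputable def fundSol' (x x' : ℝ) : ℝ := solY' x * solJ x' - solJ' x * solY x'

theorem hasDerivAt_fundSol {x : ℝ} (hx : 0 < x) (x' : ℝ) :
    HasDerivAt (fun y => fundSol y x') (fundSol' x x') x :=
  ((hasDerivAt_solY hx).mul_const _).sub ((hasDerivAt_solJ x).mul_const _)

theorem hasDerivAt_fundSol' {x : ℝ} (hx : 0 < x) (x' : ℝ) :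
    HasDerivAt (fun y => fundSol' y x') (-fundSol x x' / x) x := by
  have h := ((hasDerivAt_solY' hx).mul_const (solJ x')).sub
    ((hasDerivAt_solJ' hx).mul_const (solY x'))
  exact h.congr_deriv (by rw [fundSol]; ring)

/-- Along solutions of `f'' = -f/x` the energy `f'² + f²/x` has derivative `-(f/x)²`. At `x = x'`
the value of `fundSol` is zero and its slope is the Wronskian, which fixes the initial energy. -/
theorem fundSol_energy_le {x x' : ℝ} (hx' : 0 < x') (h : x' ≤ x) :
    fundSol' x x' ^ 2 + fundSol x x' ^ 2 / x ≤ wronskian 1 ^ 2 := by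
  have hd : ∀ y ∈ Ioi (0 : ℝ), HasDerivAt (fun y => fundSol' y x' ^ 2 + fundSol y x' ^ 2 / y)
      (-(fundSol y x' / y) ^ 2) y := fun y hy => by
    have hy0 : y ≠ 0 := (mem_Ioi.1 hy).ne'
    have h := ((hasDerivAt_fundSol' hy x').pow 2).add
      (((hasDerivAt_fundSol hy x').pow 2).div (hasDerivAt_id y) hy0)
    refine h.congr_deriv ?_
    simp only [id]
    push_cast
    field_simp
    simp
    ring
  have hanti : AntitoneOn (fun y => fundSol' y x' ^ 2 + fundSol y x' ^ 2 / y) (Ioi 0) := by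
    refine antitoneOn_of_deriv_nonpos (convex_Ioi 0)
      (fun y hy => (hd y hy).continuousAt.continuousWithinAt)
      (fun y hy => ?_) (fun y hy => ?_)
    · rw [interior_Ioi] at hy
      exact (hd y hy).differentiableAt.differentiableWithinAt
    · rw [interior_Ioi] at hy
      rw [(hd y hy).deriv]
      nlinarith [sq_nonneg (fundSol y x' / y)]
  refine (hanti hx' (hx'.trans_le h) h).trans (le_of_eq ?_)
  have h0 : fundSol x' x' = 0 := by rw [fundSol]; ring
  have h1 : fundSol' x' x' = wronskian 1 := by rw [← wronskian_eq hx']; rfl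
  simp only [h0, h1]
  simp

theorem abs_fundSol_le_sqrt {x x' : ℝ} (hx' : 0 < x') (h : x' ≤ x) :
    |fundSol x x'| ≤ |wronskian 1| * √x := by
  have hx : 0 < x := hx'.trans_le h
  have h1 : fundSol x x' ^ 2 / x ≤ wronskian 1 ^ 2 := by
    nlinarith [fundSol_energy_le hx' h, sq_nonneg (fundSol' x x')]
  rw [div_le_iff₀ hx] at h1
  rw [← Real.sqrt_sq_eq_abs, ← Real.sqrt_sq_eq_abs, ← Real.sqrt_mul (sq_nonneg _)]
  exact Real.sqrt_le_sqrt h1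

/-- The energy also bounds the slope by `|wronskian 1|`, so the mean value inequality from the zero
at `x'` applies. This bound has no singularity at small `x` once divided by `x`. -/
theorem abs_fundSol_le {x x' : ℝ} (hx' : 0 < x') (h : x' ≤ x) :
    |fundSol x x'| ≤ |wronskian 1| * x := by
  have h0 : fundSol x' x' = 0 := by rw [fundSol]; ring
  have key := (convex_Icc x' x).norm_image_sub_le_of_norm_hasDerivWithin_le
    (f := fun y => fundSol y x') (f' := fun y => fundSol' y x') (C := |wronskian 1|)
    (fun y hy => (hasDerivAt_fundSol (hx'.trans_le hy.1) x').hasDerivWithinAt)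
    (fun y hy => by
      rw [Real.norm_eq_abs, ← sq_le_sq]
      have := fundSol_energy_le hx' hy.1
      have h3 : 0 ≤ fundSol y x' ^ 2 / y := div_nonneg (sq_nonneg _) (hx'.trans_le hy.1).le
      linarith)
    (left_mem_Icc.2 h) (right_mem_Icc.2 h)
  simp only [h0, sub_zero, Real.norm_eq_abs] at key
  refine key.trans ?_
  rw [abs_of_nonneg (sub_nonneg.2 h)]
  gcongr
  linarith

/-- Serves integrability on all of `(0, p]`; the quantitative estimate beyond `p₀` uses the suprema
in `ℬ₃` and `ℬ₄` instead. -/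
theorem abs_borelKernel_le {d : ℕ} {κ : ℝ} (hκ : 0 < κ) (k : Wave d) {p p' : ℝ}
    (hp' : 0 < p') (h : p' ≤ p) : |borelKernel κ k p p'| ≤ max 1 |wronskian 1| := by
  have hp : 0 < p := hp'.trans_le h
  by_cases hk : k = 0
  · rw [borelKernel, if_pos hk]
    refine le_max_of_le_left ?_
    have h1 : p' / p ≤ 1 := (div_le_one hp).2 h
    have h2 : 0 < p' / p := by positivity
    rw [abs_le]; constructor <;> linarith
  · have hk' : 0 < ‖k‖ := norm_pos_iff.2 hk
    refine le_max_of_le_right ?_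
    rw [borelKernel_eq hκ hk hp hp', abs_div, abs_of_pos (a := κ * ‖k‖ ^ 2 * p) (by positivity),
      div_le_iff₀ (by positivity)]
    exact abs_fundSol_le (by positivity) (by gcongr)

/-- With `x = κ|k|²p` the square-root bound gives `|k| √x / x = 1 / √(κp)`: the factor `|k|` cancels
exactly, and `p ≥ p₀` finishes. -/
theorem norm_mul_abs_borelKernel_le {d : ℕ} {κ : ℝ} (hκ : 0 < κ) (k : Wave d) {p₀ p p' : ℝ}
    (hp₀ : 0 < p₀) (hp' : p₀ ≤ p') (h : p' ≤ p) :
    ‖k‖ * |borelKernel κ k p p'| ≤ |wronskian 1| / √(κ * p₀) := by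
  have hp'0 : 0 < p' := hp₀.trans_le hp'
  have hp : 0 < p := hp'0.trans_le h
  by_cases hk : k = 0
  · rw [hk, norm_zero, zero_mul]; positivity
  · have hk' : 0 < ‖k‖ := norm_pos_iff.2 hk
    rw [borelKernel_eq hκ hk hp hp'0, abs_div, abs_of_pos (a := κ * ‖k‖ ^ 2 * p) (by positivity)]
    have h1 := abs_fundSol_le_sqrt (x := κ * ‖k‖ ^ 2 * p) (x' := κ * ‖k‖ ^ 2 * p')
      (by positivity) (by gcongr)
    have h2 : √(κ * ‖k‖ ^ 2 * p) = ‖k‖ * √(κ * p) := by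
      rw [show κ * ‖k‖ ^ 2 * p = ‖k‖ ^ 2 * (κ * p) by ring, Real.sqrt_mul (by positivity),
        Real.sqrt_sq hk'.le]
    have h3 : κ * ‖k‖ ^ 2 * p = (‖k‖ * √(κ * p)) ^ 2 := by
      rw [mul_pow, Real.sq_sqrt (by positivity)]; ring
    have h4 : 0 < √(κ * p) := by positivity
    calc ‖k‖ * (|fundSol (κ * ‖k‖ ^ 2 * p) (κ * ‖k‖ ^ 2 * p')| / (κ * ‖k‖ ^ 2 * p))
        ≤ ‖k‖ * (|wronskian 1| * √(κ * ‖k‖ ^ 2 * p) / (κ * ‖k‖ ^ 2 * p)) := by gcongr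
      _ = |wronskian 1| / √(κ * p) := by
          rw [h2, h3]; field_simp
      _ ≤ |wronskian 1| / √(κ * p₀) := by
          gcongr; linarith

theorem continuousOn_borelKernel {d : ℕ} {κ : ℝ} (hκ : 0 < κ) (k : Wave d) {p : ℝ} (hp : 0 < p) :
    ContinuousOn (borelKernel κ k p) (Ioi 0) := by
  by_cases hk : k = 0
  · have : Continuous fun p' : ℝ => 1 - p' / p := by fun_prop
    exact this.continuousOn.congr fun p' _ => by simp [borelKernel, hk]
  · have hk' : 0 < ‖k‖ := norm_pos_iff.2 hk
    intro p' hp'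
    have hp'0 : 0 < p' := hp'
    have hJ : ContinuousAt (fun q => solJ (κ * ‖k‖ ^ 2 * q)) p' :=
      (hasDerivAt_solJ _).continuousAt.comp (f := fun q => κ * ‖k‖ ^ 2 * q) (by fun_prop)
    have hY : ContinuousAt (fun q => solY (κ * ‖k‖ ^ 2 * q)) p' :=
      (hasDerivAt_solY (by positivity)).continuousAt.comp
        (f := fun q => κ * ‖k‖ ^ 2 * q) (by fun_prop)
    have : ContinuousAt (fun q => fundSol (κ * ‖k‖ ^ 2 * p) (κ * ‖k‖ ^ 2 * q)
        / (κ * ‖k‖ ^ 2 * p)) p' :=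
      ((continuousAt_const.mul hJ).sub (continuousAt_const.mul hY)).div_const _
    exact this.continuousWithinAt.congr (fun q hq => borelKernel_eq hκ hk hp hq)
      (borelKernel_eq hκ hk hp hp'0)

/-- If `fundSol` vanished identically, letting `x' → 0`, where `solJ → 0` and `solY → -1`, would
force `solJ x = 0` for every `x > 0`, against `seriesJ 0 = 1`. -/
theorem exists_fundSol_ne_zero : ∃ x x' : ℝ, 0 < x' ∧ x' < x ∧ fundSol x x' ≠ 0 := by
  by_contra! hcon
  have hJ0 : Filter.Tendsto solJ (nhdsWithin 0 (Ioi 0)) (nhds 0) := by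
    have := (hasDerivAt_solJ 0).continuousAt.tendsto.mono_left
      (nhdsWithin_le_nhds (s := Ioi (0 : ℝ)))
    simpa [solJ] using this
  have hY0 : Filter.Tendsto solY (nhdsWithin 0 (Ioi 0)) (nhds (-1)) := by
    have c1 : Filter.Tendsto seriesJ (nhdsWithin 0 (Ioi 0)) (nhds (seriesJ 0)) :=
      (entireCoeff_coeffJ.hasDerivAt 0).continuousAt.tendsto.mono_left nhdsWithin_le_nhds
    have c2 : Filter.Tendsto (fun x => x * seriesY x) (nhdsWithin 0 (Ioi 0))
        (nhds (0 * seriesY 0)) :=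
      (continuousAt_id.mul (entireCoeff_coeffY.hasDerivAt 0).continuousAt).tendsto.mono_left
        nhdsWithin_le_nhds
    have c3 : Filter.Tendsto (fun x => Real.log x * x) (nhdsWithin 0 (Ioi 0)) (nhds 0) := by
      have := tendsto_log_mul_rpow_nhdsGT_zero (r := 1) one_pos
      simpa using this
    have := ((c3.mul c1).const_add (-1)).sub c2
    simp only [zero_mul, add_zero, sub_zero] at this
    refine this.congr fun x => ?_
    rw [solY, solJ]; ring
  have hJ : ∀ x : ℝ, 0 < x → solJ x = 0 := fun x hx => by
    have t1 := (hJ0.const_mul (solY x)).sub (hY0.const_mul (solJ x))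
    have t2 : Filter.Tendsto (fun x' => solY x * solJ x' - solJ x * solY x')
        (nhdsWithin 0 (Ioi 0)) (nhds 0) := by
      refine tendsto_const_nhds.congr' ?_
      filter_upwards [Ioo_mem_nhdsGT hx] with x' hx'
      exact (hcon x x' hx'.1 hx'.2).symm
    have := tendsto_nhds_unique t1 t2
    linarith
  have hs : Filter.Tendsto seriesJ (nhdsWithin 0 (Ioi 0)) (nhds 1) := by
    have : seriesJ 0 = 1 := by rw [seriesJ, powerSum_zero]; simp [coeffJ]
    rw [← this]
    exact (entireCoeff_coeffJ.hasDerivAt 0).continuousAt.tendsto.mono_left nhdsWithin_le_nhds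
  have hs0 : Filter.Tendsto seriesJ (nhdsWithin 0 (Ioi 0)) (nhds 0) := by
    refine tendsto_const_nhds.congr' ?_
    filter_upwards [self_mem_nhdsWithin] with x hx
    have := hJ x hx
    rw [solJ, mul_eq_zero] at this
    exact (this.resolve_left (mem_Ioi.1 hx).ne').symm
  exact one_ne_zero (tendsto_nhds_unique hs hs0)

/-! ### The norms on nonnegative functions -/

/-- `‖·‖_N` of a nonnegative function of `k`. -/
noncomputable def FourierNorm.enrm {d : ℕ} (N : FourierNorm) (g : Wave d → ℝ≥0∞) : ℝ≥0∞ :=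
  match N with
  | .weighted γ β =>
      ⨆ k : Wave d, ENNReal.ofReal ((1 + ‖k‖) ^ γ * Real.exp (β * ‖k‖)) * g k
  | .l1linf => max (∫⁻ k : Wave d, g k) (⨆ k : Wave d, g k)

namespace FourierNorm

variable {d : ℕ} (N : FourierNorm)

theorem nrm_eq_enrm (g : Wave d → ℝ) : N.nrm g = N.enrm fun k => ‖g k‖ₑ := by
  cases N <;> rfl

variable {N}

theorem enrm_mono {f g : Wave d → ℝ≥0∞} (h : ∀ k, f k ≤ g k) : N.enrm f ≤ N.enrm g := by
  cases N with
  | weighted γ β => exact iSup_mono fun k => by gcongr; exact h k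
  | l1linf => exact max_le_max (lintegral_mono h) (iSup_mono h)

/-- Only one summand has to be measurable. This matters because the other one will be the norm
density of `(Ĥ, Ŝ)^{(s)}`, whose measurability is never established. -/
theorem enrm_add_le (f : Wave d → ℝ≥0∞) {g : Wave d → ℝ≥0∞} (hg : Measurable g) :
    N.enrm (fun k => f k + g k) ≤ N.enrm f + N.enrm g := by
  cases N with
  | weighted γ β =>
    refine iSup_le fun k => ?_
    rw [mul_add]
    exact add_le_add
      (le_iSup (fun k : Wave d => ENNReal.ofReal ((1 + ‖k‖) ^ γ * Real.exp (β * ‖k‖)) * f k) k)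
      (le_iSup (fun k : Wave d => ENNReal.ofReal ((1 + ‖k‖) ^ γ * Real.exp (β * ‖k‖)) * g k) k)
  | l1linf =>
    refine max_le ?_ (iSup_le fun k => ?_)
    · rw [lintegral_add_right _ hg]
      exact add_le_add (le_max_left _ _) (le_max_left _ _)
    · exact add_le_add (le_max_of_le_right (le_iSup f k)) (le_max_of_le_right (le_iSup g k))

theorem enrm_const_mul_le (c : ℝ≥0∞) {g : Wave d → ℝ≥0∞} (hg : Measurable g) :
    N.enrm (fun k => c * g k) ≤ c * N.enrm g := by
  cases N with
  | weighted γ β =>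
    refine iSup_le fun k => ?_
    rw [mul_left_comm]
    gcongr
    exact le_iSup (fun k : Wave d => ENNReal.ofReal ((1 + ‖k‖) ^ γ * Real.exp (β * ‖k‖)) * g k) k
  | l1linf =>
    refine max_le ?_ (iSup_le fun k => ?_)
    · rw [lintegral_const_mul _ hg]
      gcongr
      exact le_max_left _ _
    · exact mul_le_mul_right (le_max_of_le_right (le_iSup g k)) c

theorem enrm_lintegral_le {α : Type*} [MeasurableSpace α] (m : Measure α) [SFinite m]
    {F : Wave d → α → ℝ≥0∞} (hF : Measurable (Function.uncurry F)) :
    N.enrm (fun k => ∫⁻ s, F k s ∂m) ≤ ∫⁻ s, N.enrm (fun k => F k s) ∂m := by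
  cases N with
  | weighted γ β =>
    refine iSup_le fun k => ?_
    rw [← lintegral_const_mul' _ _ ENNReal.ofReal_ne_top]
    exact lintegral_mono fun s => le_iSup
      (fun k : Wave d => ENNReal.ofReal ((1 + ‖k‖) ^ γ * Real.exp (β * ‖k‖)) * F k s) k
  | l1linf =>
    refine max_le ?_ (iSup_le fun k => ?_)
    · rw [lintegral_lintegral_swap hF.aemeasurable]
      exact lintegral_mono fun s => le_max_left _ _
    · exact lintegral_mono fun s => le_max_of_le_right (le_iSup (fun k => F k s) k)

theorem one_le_weight {γ β : ℝ} (hγ : 0 ≤ γ) (hβ : 0 ≤ β) (k : Wave d) :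
    1 ≤ (1 + ‖k‖) ^ γ * Real.exp (β * ‖k‖) := by
  have h1 : 1 ≤ (1 + ‖k‖) ^ γ := Real.one_le_rpow (by linarith [norm_nonneg k]) hγ
  have h2 : 1 ≤ Real.exp (β * ‖k‖) := Real.one_le_exp (by positivity)
  nlinarith

/-- Both norms contain a true supremum, not an essential one. Norm bounds therefore hold at each
fixed `k`, which is what makes the integrals at fixed `k` converge. -/
theorem le_enrm (hN : N.Admissible d) (g : Wave d → ℝ≥0∞) (k : Wave d) : g k ≤ N.enrm g := by
  cases N with
  | weighted γ β =>
    have hγ : 0 ≤ γ := (Nat.cast_nonneg d).trans hN.1.le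
    refine le_trans ?_ (le_iSup (fun k : Wave d =>
      ENNReal.ofReal ((1 + ‖k‖) ^ γ * Real.exp (β * ‖k‖)) * g k) k)
    refine le_mul_of_one_le_left zero_le ?_
    rw [ENNReal.one_le_ofReal]
    exact one_le_weight hγ hN.2 k
  | l1linf => exact le_max_of_le_right (le_iSup g k)

/-- One of `|q|`, `|k - q|` is at least `|k|/2`, so `(1+|k|)^γ ≤ 2^γ ((1+|q|)^γ + (1+|k-q|)^γ)`. The
form chosen factors out both weights; the two inverse powers left over have equal integrals over
`q`, whence the exponent `γ + 1` of `2` in `C₀`. -/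
theorem weight_le {γ β : ℝ} (hγ : 0 ≤ γ) (hβ : 0 ≤ β) (k q : Wave d) :
    (1 + ‖k‖) ^ γ * Real.exp (β * ‖k‖) ≤
      2 ^ γ * ((1 + ‖k - q‖) ^ (-γ) + (1 + ‖q‖) ^ (-γ)) *
        (((1 + ‖q‖) ^ γ * Real.exp (β * ‖q‖)) * ((1 + ‖k - q‖) ^ γ * Real.exp (β * ‖k - q‖))) := by
  have hk : ‖k‖ ≤ ‖q‖ + ‖k - q‖ := by
    simpa using norm_add_le q (k - q)
  have hq0 := norm_nonneg q
  have hr0 := norm_nonneg (k - q)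
  have hk0 := norm_nonneg k
  generalize ‖k‖ = x at *
  generalize ‖q‖ = y at *
  generalize ‖k - q‖ = z at *
  have he : Real.exp (β * x) ≤ Real.exp (β * y) * Real.exp (β * z) := by
    rw [← Real.exp_add]
    exact Real.exp_le_exp.2 (by nlinarith)
  have hy : (1 + y) ^ γ * (1 + y) ^ (-γ) = 1 := by
    rw [← Real.rpow_add (by linarith)]; simp
  have hz : (1 + z) ^ γ * (1 + z) ^ (-γ) = 1 := by
    rw [← Real.rpow_add (by linarith)]; simp
  have hp : (1 + x) ^ γ ≤ 2 ^ γ * ((1 + y) ^ γ + (1 + z) ^ γ) := by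
    have hmax : (1 + x) ^ γ ≤ 2 ^ γ * (1 + max y z) ^ γ := by
      rw [← Real.mul_rpow (by norm_num) (by positivity)]
      refine Real.rpow_le_rpow (by positivity) ?_ hγ
      linarith [le_max_left y z, le_max_right y z]
    refine hmax.trans ?_
    gcongr
    have h1 : 0 ≤ (1 + y) ^ γ := by positivity
    have h2 : 0 ≤ (1 + z) ^ γ := by positivity
    rcases le_total y z with h | h
    · rw [max_eq_right h]; linarith
    · rw [max_eq_left h]; linarith
  calc (1 + x) ^ γ * Real.exp (β * x)
      ≤ (2 ^ γ * ((1 + y) ^ γ + (1 + z) ^ γ)) * (Real.exp (β * y) * Real.exp (β * z)) := by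
        gcongr
    _ = _ := by
        linear_combination (-(2 : ℝ) ^ γ * Real.exp (β * y) * Real.exp (β * z))
          * ((1 + y) ^ γ * hz + (1 + z) ^ γ * hy)

/-- The algebra property of the norms. -/
theorem enrm_conv_le (hN : N.Admissible d) {f g : Wave d → ℝ≥0∞} (hf : Measurable f)
    (hg : Measurable g) :
    N.enrm (fun k => ∫⁻ q, f q * g (k - q)) ≤ N.C0 d * (N.enrm f * N.enrm g) := by
  cases N with
  | weighted γ β =>
    have hγ : 0 ≤ γ := (Nat.cast_nonneg d).trans hN.1.le
    set w : Wave d → ℝ := fun k => (1 + ‖k‖) ^ γ * Real.exp (β * ‖k‖) with hw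
    have hw0 : ∀ k, 0 ≤ w k := fun k => by positivity
    set φ : Wave d → ℝ≥0∞ := fun k => ENNReal.ofReal ((1 + ‖k‖) ^ (-γ)) with hφ
    have hφm : Measurable φ := by
      simp only [hφ]; fun_prop
    refine iSup_le fun k => ?_
    have hF : ∀ q, ENNReal.ofReal (w q) * f q ≤ (FourierNorm.weighted γ β).enrm f := fun q =>
      le_iSup (fun k : Wave d => ENNReal.ofReal ((1 + ‖k‖) ^ γ * Real.exp (β * ‖k‖)) * f k) q
    have hG : ∀ q, ENNReal.ofReal (w q) * g q ≤ (FourierNorm.weighted γ β).enrm g := fun q =>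
      le_iSup (fun k : Wave d => ENNReal.ofReal ((1 + ‖k‖) ^ γ * Real.exp (β * ‖k‖)) * g k) q
    set F := (FourierNorm.weighted γ β).enrm f
    set G := (FourierNorm.weighted γ β).enrm g
    rw [← lintegral_const_mul' _ _ ENNReal.ofReal_ne_top]
    calc ∫⁻ q, ENNReal.ofReal (w k) * (f q * g (k - q))
        ≤ ∫⁻ q, (ENNReal.ofReal (2 ^ γ) * (φ (k - q) + φ q)) * (F * G) := by
          refine lintegral_mono fun q => ?_
          have h1 : ENNReal.ofReal (w k) ≤ ENNReal.ofReal (2 ^ γ) * (φ (k - q) + φ q) *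
              (ENNReal.ofReal (w q) * ENNReal.ofReal (w (k - q))) := by
            simp only [hφ]
            rw [← ENNReal.ofReal_add (by positivity) (by positivity),
              ← ENNReal.ofReal_mul (by positivity), ← ENNReal.ofReal_mul (hw0 _),
              ← ENNReal.ofReal_mul (by positivity)]
            exact ENNReal.ofReal_le_ofReal (weight_le hγ hN.2 k q)
          calc ENNReal.ofReal (w k) * (f q * g (k - q))
              ≤ ENNReal.ofReal (2 ^ γ) * (φ (k - q) + φ q) *
              (ENNReal.ofReal (w q) * ENNReal.ofReal (w (k - q))) * (f q * g (k - q)) := by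
                gcongr
            _ = ENNReal.ofReal (2 ^ γ) * (φ (k - q) + φ q) *
              ((ENNReal.ofReal (w q) * f q) * (ENNReal.ofReal (w (k - q)) * g (k - q))) := by ring
            _ ≤ _ := by
                gcongr
                · exact hF q
                · exact hG (k - q)
      _ = ENNReal.ofReal (2 ^ γ) * ((∫⁻ q, φ q) + ∫⁻ q, φ q) * (F * G) := by
          have hm : Measurable fun q => φ (k - q) := hφm.comp (measurable_const.sub measurable_id)
          rw [lintegral_mul_const _ (by fun_prop), lintegral_const_mul _ (by fun_prop),
            lintegral_add_left hm, lintegral_sub_left_eq_self φ k]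
      _ = _ := by
          rw [FourierNorm.C0, Real.rpow_add two_pos, Real.rpow_one,
            ENNReal.ofReal_mul (by positivity)]
          simp only [ENNReal.ofReal_ofNat, hφ]
          ring
  | l1linf =>
    rw [FourierNorm.C0, one_mul]
    refine max_le ?_ (iSup_le fun k => ?_)
    · have hm : Measurable (Function.uncurry fun k q : Wave d => f q * g (k - q)) := by
        fun_prop
      rw [lintegral_lintegral_swap hm.aemeasurable]
      calc ∫⁻ q, ∫⁻ k, f q * g (k - q) = ∫⁻ q, f q * ∫⁻ k, g k := by
            refine lintegral_congr fun q => ?_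
            rw [lintegral_const_mul _ (by fun_prop), lintegral_sub_right_eq_self g q]
        _ = (∫⁻ q, f q) * ∫⁻ k, g k := lintegral_mul_const _ hf
        _ ≤ _ := mul_le_mul' (le_max_left _ _) (le_max_left _ _)
    · calc ∫⁻ q, f q * g (k - q) ≤ ∫⁻ q, f q * ⨆ k, g k := by
            refine lintegral_mono fun q => ?_
            gcongr
            exact le_iSup g _
        _ = (∫⁻ q, f q) * ⨆ k, g k := lintegral_mul_const _ hf
        _ ≤ _ := mul_le_mul' (le_max_left _ _) (le_max_right _ _)

/-- `ℬ₄` carries a factor `C₀` although the buoyancy term involves no convolution; this inequality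
lets `ℬ₄` dominate that term. On the unit ball `(1+|k|)^{-γ} ≥ 2^{-γ}`, so `C₀` is at least twice
the volume of the ball, which is `π` or `4π/3` in the two dimensions allowed. -/
theorem one_le_C0 (hd : d = 2 ∨ d = 3) (hN : N.Admissible d) : 1 ≤ N.C0 d := by
  cases N with
  | l1linf => exact le_rfl
  | weighted γ β =>
    have hγ : 0 ≤ γ := (Nat.cast_nonneg d).trans hN.1.le
    have hvol : 1 ≤ volume (Metric.ball (0 : Wave d) 1) := by
      have hpi := Real.pi_gt_three
      rcases hd with rfl | rfl
      · rw [EuclideanSpace.volume_ball_fin_two]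
        rw [ENNReal.ofReal_one, one_pow, one_mul, ENNReal.one_le_ofReal]
        linarith
      · rw [EuclideanSpace.volume_ball_fin_three]
        rw [ENNReal.ofReal_one, one_pow, one_mul, ENNReal.one_le_ofReal]
        linarith
    rw [FourierNorm.C0]
    calc (1 : ℝ≥0∞) ≤ 2 * volume (Metric.ball (0 : Wave d) 1) :=
          hvol.trans (le_mul_of_one_le_left zero_le one_le_two)
      _ = ENNReal.ofReal (2 ^ (γ + 1)) *
            ∫⁻ _ in Metric.ball (0 : Wave d) 1, ENNReal.ofReal (2 ^ (-γ)) := by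
          rw [setLIntegral_const, ← mul_assoc, ← ENNReal.ofReal_mul (by positivity),
            ← Real.rpow_add two_pos]
          simp
      _ ≤ _ := by
          refine mul_le_mul_right ?_ _
          refine (setLIntegral_mono' measurableSet_ball fun k hk => ?_).trans
            (setLIntegral_le_lintegral _ _)
          refine ENNReal.ofReal_le_ofReal
            (Real.rpow_le_rpow_of_nonpos (by positivity) ?_ (by simpa))
          have := mem_ball_zero_iff.1 hk
          linarith

theorem C0_lt_top (hN : N.Admissible d) : N.C0 d < ∞ := by
  cases N with
  | l1linf => exact ENNReal.one_lt_top
  | weighted γ β =>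
    refine ENNReal.mul_lt_top ENNReal.ofReal_lt_top (finite_integral_one_add_norm ?_)
    simpa using hN.1

end FourierNorm

/-! ### The kernel constants -/

section Kernel

variable {d : ℕ} (D : Data d) (p₀ : ℝ)

/-- The supremum over `p₀ ≤ p' ≤ p` of the two kernels. -/
noncomputable def kernelSup (k : Wave d) : ℝ≥0∞ :=
  ⨆ (p' : ℝ) (p : ℝ) (_ : p₀ ≤ p' ∧ p' ≤ p),
    max ‖borelKernel D.ν k p p'‖ₑ ‖borelKernel D.μ k p p'‖ₑ

variable {p₀}

theorem le_kernelSup (k : Wave d) {p p' : ℝ} (h₀ : p₀ ≤ p') (h : p' ≤ p) :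
    max ‖borelKernel D.ν k p p'‖ₑ ‖borelKernel D.μ k p p'‖ₑ ≤ kernelSup D p₀ k :=
  le_iSup_of_le p' (le_iSup_of_le p (le_iSup_of_le ⟨h₀, h⟩ le_rfl))

theorem B3_eq (N : FourierNorm) :
    B3 N D p₀ = N.C0 d * ⨆ k : Wave d, ‖k‖ₑ * kernelSup D p₀ k := by
  simp only [B3, ENNReal.mul_iSup]
  exact iSup_congr fun k => by rw [mul_left_comm]; rfl

theorem B4_eq (N : FourierNorm) :
    B4 N D p₀ = ENNReal.ofReal D.a * (N.C0 d * ⨆ k : Wave d, kernelSup D p₀ k) := by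
  simp only [B4, ENNReal.mul_iSup]
  rfl

variable {D}

theorem iSup_norm_mul_kernelSup_lt_top (hν : 0 < D.ν) (hμ : 0 < D.μ) (hp₀ : 0 < p₀) :
    ⨆ k : Wave d, ‖k‖ₑ * kernelSup D p₀ k < ∞ := by
  set C := max (|wronskian 1| / √(D.ν * p₀)) (|wronskian 1| / √(D.μ * p₀))
  refine lt_of_le_of_lt (iSup_le fun k => ?_) (ENNReal.ofReal_lt_top (r := C))
  simp only [kernelSup, ENNReal.mul_iSup]
  refine iSup_le fun p' => iSup_le fun p => iSup_le fun h => ?_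
  rw [mul_max]
  refine max_le ?_ ?_
  · rw [← enorm_norm k, Real.enorm_eq_ofReal_abs, Real.enorm_eq_ofReal_abs,
      abs_of_nonneg (norm_nonneg k), ← ENNReal.ofReal_mul (norm_nonneg k)]
    exact ENNReal.ofReal_le_ofReal
      ((norm_mul_abs_borelKernel_le hν k hp₀ h.1 h.2).trans (le_max_left _ _))
  · rw [← enorm_norm k, Real.enorm_eq_ofReal_abs, Real.enorm_eq_ofReal_abs,
      abs_of_nonneg (norm_nonneg k), ← ENNReal.ofReal_mul (norm_nonneg k)]
    exact ENNReal.ofReal_le_ofReal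
      ((norm_mul_abs_borelKernel_le hμ k hp₀ h.1 h.2).trans (le_max_right _ _))

theorem iSup_norm_mul_kernelSup_pos (hν : 0 < D.ν) (hp₀ : 0 < p₀) (he : ‖D.e‖ = 1) :
    0 < ⨆ k : Wave d, ‖k‖ₑ * kernelSup D p₀ k := by
  obtain ⟨x, x', hx', hlt, hne⟩ := exists_fundSol_ne_zero
  have hx : 0 < x := hx'.trans hlt
  have hr : 0 < √(x' / (D.ν * p₀)) := by positivity
  -- The length is chosen so that `ν|k|²p₀ = x'`; then `p = p₀ x / x'` corresponds to `x`, and `D.e`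
  -- merely supplies a unit vector.
  set k : Wave d := √(x' / (D.ν * p₀)) • D.e with hk
  have hkn : ‖k‖ = √(x' / (D.ν * p₀)) := by
    rw [hk, norm_smul, he, mul_one, Real.norm_of_nonneg hr.le]
  have hk0 : k ≠ 0 := norm_pos_iff.1 (hkn ▸ hr)
  have hk2 : D.ν * ‖k‖ ^ 2 = x' / p₀ := by
    rw [hkn, Real.sq_sqrt (by positivity)]; field_simp
  have hK : borelKernel D.ν k (p₀ * x / x') p₀ ≠ 0 := by
    rw [borelKernel_eq hν hk0 (by positivity) hp₀, hk2,
      show x' / p₀ * (p₀ * x / x') = x by field_simp, show x' / p₀ * p₀ = x' by field_simp]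
    exact div_ne_zero hne hx.ne'
  refine lt_of_lt_of_le ?_ (le_iSup _ k)
  refine ENNReal.mul_pos (by simpa using hk0) (ne_of_gt ?_)
  refine lt_of_lt_of_le ?_ (le_kernelSup D k (p := p₀ * x / x') (p' := p₀) le_rfl ?_)
  · exact lt_max_of_lt_left (by simpa [pos_iff_ne_zero] using hK)
  · rw [le_div_iff₀ hx']
    nlinarith

end Kernel

/-! ### Laplace transforms of Volterra inequalities -/

/-- The weight `e^{-ωp}`. -/
noncomputable def expWeight (ω p : ℝ) : ℝ≥0∞ := ENNReal.ofReal (Real.exp (-ω * p))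

theorem measurable_expWeight (ω : ℝ) : Measurable (expWeight ω) := by
  unfold expWeight; fun_prop

theorem expWeight_le_one {ω p : ℝ} (hω : 0 ≤ ω) (hp : 0 ≤ p) : expWeight ω p ≤ 1 := by
  rw [expWeight, ENNReal.ofReal_le_one, Real.exp_le_one_iff]
  nlinarith

theorem expWeight_mul (ω s p : ℝ) : expWeight ω s * expWeight ω (p - s) = expWeight ω p := by
  rw [expWeight, expWeight, ← ENNReal.ofReal_mul (by positivity), ← Real.exp_add, expWeight]
  congr 2; ring

/-- Tonelli and translation invariance, with the weight multiplicative. The integrals run over the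
whole line; causality is encoded by functions vanishing at nonpositive times. -/
theorem lintegral_expWeight_conv (ω : ℝ) {f g : ℝ → ℝ≥0∞} (hf : Measurable f)
    (hg : Measurable g) :
    ∫⁻ p, expWeight ω p * ∫⁻ s, f s * g (p - s)
      = (∫⁻ p, expWeight ω p * f p) * ∫⁻ p, expWeight ω p * g p := by
  have he := measurable_expWeight ω
  have h1 : ∀ p, expWeight ω p * ∫⁻ s, f s * g (p - s)
      = ∫⁻ s, (expWeight ω s * f s) * (expWeight ω (p - s) * g (p - s)) := fun p => by
    rw [← lintegral_const_mul _ (by fun_prop)]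
    refine lintegral_congr fun s => ?_
    rw [← expWeight_mul ω s p]; ring
  simp_rw [h1]
  rw [lintegral_lintegral_swap (Measurable.aemeasurable (by fun_prop)),
    ← lintegral_mul_const _ (by fun_prop)]
  refine lintegral_congr fun s => ?_
  rw [lintegral_const_mul _ (by fun_prop),
    lintegral_sub_right_eq_self (fun p => expWeight ω p * g p) s]

theorem lintegral_expWeight_Ici {ω : ℝ} (hω : 0 < ω) (p : ℝ) :
    ENNReal.ofReal ω * ∫⁻ t in Ici p, expWeight ω t = expWeight ω p := by
  have hi : IntegrableOn (fun t => Real.exp (-ω * t)) (Ioi p) := by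
    exact integrableOn_exp_mul_Ioi (by linarith) p
  rw [setLIntegral_congr Ioi_ae_eq_Ici.symm]
  simp only [expWeight]
  rw [← ofReal_integral_eq_lintegral_ofReal hi (ae_of_all _ fun t => (Real.exp_pos _).le),
    ← ENNReal.ofReal_mul hω.le, integral_exp_mul_Ioi (by linarith)]
  congr 1
  field_simp

/-- Exchange the integrals and use `ω ∫_{p'}^∞ e^{-ωp} dp = e^{-ωp'}`. Only the lower limit `p₀` is
discarded. -/
theorem lintegral_expWeight_primitive_le {ω : ℝ} (hω : 0 < ω) {F : ℝ → ℝ≥0∞} (hF : Measurable F)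
    (p₀ : ℝ) :
    ENNReal.ofReal ω * ∫⁻ p, expWeight ω p * ∫⁻ p' in Ioc p₀ p, F p'
      ≤ ∫⁻ p, expWeight ω p * F p := by
  have he := measurable_expWeight ω
  have hm : Measurable (Function.uncurry fun p p' : ℝ =>
      (Ici p').indicator (fun p => expWeight ω p * F p') p) := by
    have : (Function.uncurry fun p p' : ℝ =>
      (Ici p').indicator (fun p => expWeight ω p * F p') p)
        = {x : ℝ × ℝ | x.2 ≤ x.1}.indicator fun x => expWeight ω x.1 * F x.2 := by
      ext ⟨p, p'⟩
      simp [indicator, Function.uncurry]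
    rw [this]
    exact Measurable.indicator (by fun_prop) (measurableSet_le measurable_snd measurable_fst)
  calc ENNReal.ofReal ω * ∫⁻ p, expWeight ω p * ∫⁻ p' in Ioc p₀ p, F p'
      ≤ ENNReal.ofReal ω * ∫⁻ p, ∫⁻ p', (Ici p').indicator (fun p => expWeight ω p * F p') p := by
        gcongr with p
        rw [← lintegral_const_mul _ hF, ← lintegral_indicator measurableSet_Ioc]
        refine lintegral_mono fun p' => ?_
        by_cases h : p' ∈ Ioc p₀ p
        · rw [indicator_of_mem h, indicator_of_mem (mem_Ici.2 h.2)]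
        · rw [indicator_of_notMem h]; exact zero_le
    _ = ENNReal.ofReal ω * ∫⁻ p', (∫⁻ p in Ici p', expWeight ω p) * F p' := by
        rw [lintegral_lintegral_swap hm.aemeasurable]
        congr 1
        refine lintegral_congr fun p' => ?_
        rw [lintegral_indicator measurableSet_Ici, lintegral_mul_const _ he]
    _ = ∫⁻ p, expWeight ω p * F p := by
        rw [← lintegral_const_mul' _ _ ENNReal.ofReal_ne_top]
        refine lintegral_congr fun p' => ?_
        rw [← mul_assoc, lintegral_expWeight_Ici hω]

/-- A continuous function that starts at `0` and satisfies a quadratic inequality with positive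
discriminant stays below the larger root. -/
theorem le_of_quadratic {X : ℝ → ℝ} (hX : Continuous X) {p₀ : ℝ} (h0 : X p₀ = 0)
    {ω ε β c : ℝ} (hβ : 0 < β) (hc : 0 ≤ c) (hlt : ε + 2 * √(β * c) < ω)
    (hq : ∀ L, p₀ ≤ L → ω * X L ≤ c + ε * X L + β * X L ^ 2) {L : ℝ} (hL : p₀ ≤ L) :
    X L ≤ (ω - ε) / (2 * β) := by
  have hs := Real.sqrt_nonneg (β * c)
  have hs2 := Real.sq_sqrt (mul_nonneg hβ.le hc)
  by_contra! hcon
  have hm0 : 0 ≤ (ω - ε) / (2 * β) := div_nonneg (by linarith) (by linarith)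
  -- The value tested is the midpoint of the two roots. If `X` attained it, the quadratic inequality
  -- there would read `(ω - ε)² ≤ 4βc`, contradicting the discriminant condition.
  obtain ⟨y, hy, hyX⟩ := intermediate_value_Icc hL hX.continuousOn
    (show (ω - ε) / (2 * β) ∈ Icc (X p₀) (X L) from ⟨by rw [h0]; exact hm0, hcon.le⟩)
  have h1 := hq y hy.1
  rw [hyX] at h1
  have h2 : (ω - ε) ^ 2 ≤ 4 * (β * c) := by
    have e : ω * ((ω - ε) / (2 * β)) - ε * ((ω - ε) / (2 * β)) - β * ((ω - ε) / (2 * β)) ^ 2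
        = (ω - ε) ^ 2 / (4 * β) := by field_simp; ring
    have h3 : (ω - ε) ^ 2 / (4 * β) ≤ c := by linarith
    rw [div_le_iff₀ (by positivity)] at h3
    linarith
  nlinarith

/-- The quadratic Volterra expression in a function `f`, restricted to `p > p₀`, and `g`. -/
noncomputable def volterra (c β : ℝ≥0∞) (g f : ℝ → ℝ≥0∞) (p : ℝ) : ℝ≥0∞ :=
  c * f p + β * ((∫⁻ s, g s * f (p - s)) + (∫⁻ s, f s * g (p - s)) + ∫⁻ s, f s * f (p - s))

theorem measurable_volterra (c β : ℝ≥0∞) {g f : ℝ → ℝ≥0∞} (hg : Measurable g)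
    (hf : Measurable f) : Measurable (volterra c β g f) := by
  have aux : ∀ {u v : ℝ → ℝ≥0∞}, Measurable u → Measurable v →
      Measurable fun p => ∫⁻ s, u s * v (p - s) := fun {u v} hu hv =>
    Measurable.lintegral_prod_right' (f := fun x : ℝ × ℝ => u x.2 * v (x.1 - x.2)) (by fun_prop)
  have h1 := aux hg hf
  have h2 := aux hf hg
  have h3 := aux hf hf
  unfold volterra
  fun_prop

theorem lintegral_expWeight_volterra (ω : ℝ) (c β : ℝ≥0∞) {g f : ℝ → ℝ≥0∞} (hg : Measurable g)
    (hf : Measurable f) {X A : ℝ≥0∞} (hX : ∫⁻ p, expWeight ω p * f p = X)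
    (hA : ∫⁻ p, expWeight ω p * g p = A) :
    ∫⁻ p, expWeight ω p * volterra c β g f p = (c + 2 * β * A) * X + β * X ^ 2 := by
  have he := measurable_expWeight ω
  have aux : ∀ {u v : ℝ → ℝ≥0∞}, Measurable u → Measurable v →
      Measurable fun p => ∫⁻ s, u s * v (p - s) := fun {u v} hu hv =>
    Measurable.lintegral_prod_right' (f := fun x : ℝ × ℝ => u x.2 * v (x.1 - x.2)) (by fun_prop)
  have h1 := aux hg hf
  have h2 := aux hf hg
  have h3 := aux hf hf
  have e : ∀ p, expWeight ω p * volterra c β g f p = c * (expWeight ω p * f p) +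
      β * ((expWeight ω p * ∫⁻ s, g s * f (p - s)) + (expWeight ω p * ∫⁻ s, f s * g (p - s))
        + expWeight ω p * ∫⁻ s, f s * f (p - s)) := fun p => by
    rw [volterra]; ring
  simp_rw [e]
  rw [lintegral_add_left (by fun_prop), lintegral_const_mul _ (by fun_prop),
    lintegral_const_mul _ (by fun_prop), lintegral_add_left (by fun_prop),
    lintegral_add_left (by fun_prop), lintegral_expWeight_conv ω hg hf,
    lintegral_expWeight_conv ω hf hg, lintegral_expWeight_conv ω hf hf, hX, hA]
  ring

/-- Exponential bound for solutions of a quadratic Volterra inequality. -/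
theorem lintegral_expWeight_lt_top_of_volterra {h hs : ℝ → ℝ≥0∞} (hm : Measurable h)
    (h0 : ∀ p ≤ 0, h p = 0) (hloc : ∀ L, ∫⁻ p in Ioc 0 L, h p < ∞) {p₀ : ℝ} (hp₀ : 0 < p₀)
    {c β : ℝ≥0∞} (hβ : 0 < β) (hβt : β < ∞) {ω : ℝ} (hω : 0 < ω)
    (hineq : ∀ᵐ p, p₀ < p → h p ≤ hs p +
      ∫⁻ p' in Ioc p₀ p, volterra c β ((Iic p₀).indicator h) ((Ioi p₀).indicator h) p')
    (hlt : (c + 2 * β * ∫⁻ p, expWeight ω p * (Iic p₀).indicator h p)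
      + 2 * (β * (ENNReal.ofReal ω * ∫⁻ p in Ioi p₀, expWeight ω p * hs p)) ^ (1 / 2 : ℝ)
        < ENNReal.ofReal ω) :
    ∫⁻ p, expWeight ω p * h p < ∞ := by
  have he := measurable_expWeight ω
  set g := (Iic p₀).indicator h with hg
  have hgm : Measurable g := hm.indicator measurableSet_Iic
  set A := ∫⁻ p, expWeight ω p * g p with hA
  set b' := ENNReal.ofReal ω * ∫⁻ p in Ioi p₀, expWeight ω p * hs p with hb'
  set ε := c + 2 * β * A with hε
  have hεt : ε < ∞ := (le_self_add.trans_lt hlt).trans ENNReal.ofReal_lt_top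
  -- Positivity of `β` is essential here: with `β = 0` the product `β * b'` would be `0` even for
  -- infinite `b'`.
  have hbt : b' < ∞ := by
    have h1 : (β * b') ^ (1 / 2 : ℝ) < ∞ := by
      refine lt_of_le_of_lt ?_ ((le_add_self.trans_lt hlt).trans ENNReal.ofReal_lt_top)
      exact le_mul_of_one_le_left zero_le one_le_two
    by_contra hcon
    rw [not_lt_top_iff.1 hcon, ENNReal.mul_top hβ.ne', ENNReal.top_rpow_of_pos (by norm_num)] at h1
    exact lt_irrefl _ h1
  have hmeas : Measurable fun p => expWeight ω p * h p := by fun_prop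
  -- the weighted integral over `(p₀, L]`
  let X : ℝ → ℝ≥0∞ := fun L => ∫⁻ p in Ioc p₀ L, expWeight ω p * h p
  have hloc' : ∀ L, ∫⁻ p in Ioc 0 L, expWeight ω p * h p < ∞ := fun L => by
    refine lt_of_le_of_lt (setLIntegral_mono' measurableSet_Ioc fun p hp => ?_) (hloc L)
    exact mul_le_of_le_one_left zero_le (expWeight_le_one hω.le hp.1.le)
  have hXt : ∀ L, X L < ∞ := fun L =>
    lt_of_le_of_lt (lintegral_mono_set (Ioc_subset_Ioc_left hp₀.le)) (hloc' L)
  have hquad : ∀ L, ENNReal.ofReal ω * X L ≤ b' + (ε * X L + β * X L ^ 2) := fun L => by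
    set f := (Ioc p₀ L).indicator h with hf
    have hfm : Measurable f := hm.indicator measurableSet_Ioc
    have hXf : ∫⁻ p, expWeight ω p * f p = X L := by
      simp only [X]
      rw [← lintegral_indicator measurableSet_Ioc]
      refine lintegral_congr fun p => ?_
      by_cases hp : p ∈ Ioc p₀ L <;> simp [hf, hp]
    have hgneg : ∀ s, s ≤ 0 → g s = 0 := fun s hs => by
      rw [hg, indicator_of_mem (mem_Iic.2 (hs.trans hp₀.le)), h0 s hs]
    have hle : ∀ p' ≤ L, volterra c β g ((Ioi p₀).indicator h) p' ≤ volterra c β g f p' := by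
      intro p' hp'
      have e1 : ∀ s ≤ L, (Ioi p₀).indicator h s ≤ f s := fun s hs => by
        by_cases hs' : p₀ < s
        · rw [hf, indicator_of_mem (mem_Ioi.2 hs'), indicator_of_mem (mem_Ioc.2 ⟨hs', hs⟩)]
        · rw [indicator_of_notMem (by simpa using hs')]; exact zero_le
      have hbneg : ∀ s, s ≤ 0 → (Ioi p₀).indicator h s = 0 := fun s hs =>
        indicator_of_notMem (by simpa using hs.trans hp₀.le) _
      unfold volterra
      gcongr c * ?_ + β * (?_ + ?_ + ?_)
      · exact e1 p' hp'
      all_goals refine lintegral_mono fun s => ?_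
      · rcases le_total s 0 with hs | hs
        · rw [hgneg s hs]; simp
        · exact mul_le_mul_right (e1 _ (by linarith)) _
      · rcases le_total s L with hs | hs
        · exact mul_le_mul_left (e1 _ hs) _
        · rw [hgneg (p' - s) (by linarith)]; simp
      · rcases le_total s 0 with hs | hs
        · rw [hbneg s hs]; simp
        · rcases le_total s L with hs' | hs'
          · exact mul_le_mul' (e1 _ hs') (e1 _ (by linarith))
          · rw [hbneg (p' - s) (by linarith)]; simp
    have hvm := measurable_volterra c β hgm hfm
    have hRm : Measurable fun p => ∫⁻ p' in Ioc p₀ p, volterra c β g f p' := by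
      have : ∀ p, ∫⁻ p' in Ioc p₀ p, volterra c β g f p'
          = ∫⁻ p', {x : ℝ × ℝ | p₀ < x.2 ∧ x.2 ≤ x.1}.indicator
              (fun x => volterra c β g f x.2) (p, p') := fun p => by
        rw [← lintegral_indicator measurableSet_Ioc]
        rfl
      simp_rw [this]
      refine Measurable.lintegral_prod_right' (f := {x : ℝ × ℝ | p₀ < x.2 ∧ x.2 ≤ x.1}.indicator
              (fun x => volterra c β g f x.2)) ?_
      exact Measurable.indicator (by fun_prop)
        ((measurableSet_lt measurable_const measurable_snd).inter
          (measurableSet_le measurable_snd measurable_fst))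
    have hstep : X L ≤ (∫⁻ p in Ioi p₀, expWeight ω p * hs p)
        + ∫⁻ p, expWeight ω p * ∫⁻ p' in Ioc p₀ p, volterra c β g f p' := by
      calc X L ≤ ∫⁻ p in Ioc p₀ L, (expWeight ω p * hs p
              + expWeight ω p * ∫⁻ p' in Ioc p₀ p, volterra c β g f p') := by
            refine setLIntegral_mono_ae' measurableSet_Ioc ?_
            filter_upwards [hineq] with p hp hpI
            rw [← mul_add]
            gcongr
            refine (hp hpI.1).trans ?_
            refine add_le_add le_rfl ?_
            exact setLIntegral_mono' measurableSet_Ioc fun p' hp' => hle p' (hp'.2.trans hpI.2)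
        _ = (∫⁻ p in Ioc p₀ L, expWeight ω p * hs p)
              + ∫⁻ p in Ioc p₀ L, expWeight ω p * ∫⁻ p' in Ioc p₀ p, volterra c β g f p' :=
            -- `hs` is not assumed measurable, so additivity rests on the second summand.
            lintegral_add_right _ (by fun_prop)
        _ ≤ _ := add_le_add (lintegral_mono_set Ioc_subset_Ioi_self)
            (setLIntegral_le_lintegral _ _)
    calc ENNReal.ofReal ω * X L ≤ ENNReal.ofReal ω * ((∫⁻ p in Ioi p₀, expWeight ω p * hs p)
        + ∫⁻ p, expWeight ω p * ∫⁻ p' in Ioc p₀ p, volterra c β g f p') := by gcongr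
      _ ≤ b' + ∫⁻ p, expWeight ω p * volterra c β g f p := by
        rw [mul_add]
        gcongr
        exact lintegral_expWeight_primitive_le hω hvm p₀
      _ = _ := by rw [lintegral_expWeight_volterra ω c β hgm hfm hXf hA.symm]
  -- the real-valued version
  have hInt : ∀ L, IntegrableOn (fun p => (expWeight ω p * h p).toReal) (Ioc 0 L) := fun L =>
    integrable_toReal_of_lintegral_ne_top hmeas.aemeasurable (hloc' L).ne
  have hXreal : ∀ L, p₀ ≤ L → (X L).toReal = ∫ p in p₀..L, (expWeight ω p * h p).toReal := by
    intro L hL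
    rw [intervalIntegral.integral_of_le hL, integral_toReal hmeas.aemeasurable]
    exact ae_lt_top hmeas (hXt L).ne
  have hneg : ∀ p ≤ 0, (expWeight ω p * h p).toReal = 0 := fun p hp => by simp [h0 p hp]
  have hintv : ∀ a b : ℝ, IntervalIntegrable (fun p => (expWeight ω p * h p).toReal)
      volume a b := fun a b => by
    rw [intervalIntegrable_iff]
    have h1 : IntegrableOn (fun p => (expWeight ω p * h p).toReal) (Iic 0) :=
      (integrableOn_zero).congr_fun (fun p hp => (hneg p hp).symm) measurableSet_Iic
    refine (h1.union (hInt (max a b))).mono_set fun p hp => ?_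
    rcases le_or_gt p 0 with h' | h'
    · exact Or.inl h'
    · exact Or.inr ⟨h', hp.2⟩
  have hcont : Continuous fun L => ∫ p in p₀..L, (expWeight ω p * h p).toReal :=
    intervalIntegral.continuous_primitive hintv p₀
  have hbound : ∀ L, p₀ ≤ L → (X L).toReal ≤ (ω - ε.toReal) / (2 * β.toReal) := by
    intro L hL
    rw [hXreal L hL]
    refine le_of_quadratic (c := b'.toReal) hcont (by simp)
      (ENNReal.toReal_pos hβ.ne' hβt.ne) ENNReal.toReal_nonneg ?_ ?_ hL
    · have h1 := (ENNReal.toReal_lt_toReal (hlt.trans ENNReal.ofReal_lt_top).ne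
        ENNReal.ofReal_ne_top).2 hlt
      have h2 : 2 * (β * b') ^ (1 / 2 : ℝ) ≠ ∞ :=
        (lt_of_le_of_lt le_add_self (hlt.trans ENNReal.ofReal_lt_top)).ne
      rw [ENNReal.toReal_add hεt.ne h2, ENNReal.toReal_mul, ← ENNReal.toReal_rpow,
        ENNReal.toReal_mul, ENNReal.toReal_ofReal hω.le] at h1
      rw [Real.sqrt_eq_rpow]
      simpa using h1
    · intro M hM
      rw [← hXreal M hM]
      have h1 := hquad M
      have hXM := (hXt M).ne
      have h2 : b' + (ε * X M + β * X M ^ 2) ≠ ∞ := by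
        have := ENNReal.mul_ne_top hεt.ne hXM
        have := ENNReal.mul_ne_top hβt.ne (ENNReal.pow_ne_top hXM (n := 2))
        exact ENNReal.add_ne_top.2 ⟨hbt.ne, ENNReal.add_ne_top.2 ⟨‹_›, ‹_›⟩⟩
      have h3 := ENNReal.toReal_mono h2 h1
      rw [ENNReal.toReal_add hbt.ne (by exact fun h => h2 (by simp [h])),
        ENNReal.toReal_add (ENNReal.mul_ne_top hεt.ne hXM)
          (ENNReal.mul_ne_top hβt.ne (ENNReal.pow_ne_top hXM)),
        ENNReal.toReal_mul, ENNReal.toReal_ofReal hω.le, ENNReal.toReal_mul (a := ε),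
        ENNReal.toReal_mul (a := β), ENNReal.toReal_pow] at h3
      linarith
  have hX : ∀ L, X L ≤ ENNReal.ofReal ((ω - ε.toReal) / (2 * β.toReal)) := by
    intro L
    rcases le_total p₀ L with hL | hL
    · rw [← ENNReal.ofReal_toReal (hXt L).ne]
      exact ENNReal.ofReal_le_ofReal (hbound L hL)
    · simp [X, Ioc_eq_empty (not_lt.2 hL)]
  have hIoi : ∫⁻ p in Ioi p₀, expWeight ω p * h p
      ≤ ENNReal.ofReal ((ω - ε.toReal) / (2 * β.toReal)) := by
    have hU : (⋃ n : ℕ, Ioc p₀ (n : ℝ)) = Ioi p₀ := iUnion_Ioc_eq_Ioi_self_iff.2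
      fun x _ => exists_nat_ge x
    rw [← hU, setLIntegral_iUnion_of_directed]
    · exact iSup_le fun n => hX n
    · exact Monotone.directed_le fun m n hmn => Ioc_subset_Ioc_right (by exact_mod_cast hmn)
  have hIic : ∫⁻ p in Iic p₀, expWeight ω p * h p < ∞ := by
    refine lt_of_le_of_lt ?_ (hloc' p₀)
    rw [← lintegral_indicator measurableSet_Iic, ← lintegral_indicator measurableSet_Ioc]
    refine lintegral_mono fun p => ?_
    rcases le_or_gt p 0 with hp | hp
    · by_cases h' : p ∈ Iic p₀ <;> simp [h0 p hp, indicator]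
    · by_cases h' : p ≤ p₀ <;> simp [indicator, h', hp]
  rw [← lintegral_add_compl _ measurableSet_Iic (A := Iic p₀), compl_Iic]
  exact ENNReal.add_lt_top.2 ⟨hIic, hIoi.trans_lt ENNReal.ofReal_lt_top⟩

/-! ### The modulus of pairs and the Hodge projection -/

section Pairs

variable {d : ℕ}

/-- The modulus of a pair, as an extended nonnegative number. -/
noncomputable def pairE (v : CVec d) (s : ℂ) : ℝ≥0∞ := ‖pairAbs v s‖ₑ

theorem pairE_eq_enorm (v : CVec d) (s : ℂ) : pairE v s = ‖WithLp.toLp 2 (v, s)‖ₑ := by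
  rw [pairE, pairAbs, ← enorm_norm (WithLp.toLp 2 (v, s)), WithLp.prod_norm_eq_of_L2]
  rfl

theorem pairE_eq_ofReal (v : CVec d) (s : ℂ) : pairE v s = ENNReal.ofReal (pairAbs v s) := by
  rw [pairE, pairAbs, Real.enorm_of_nonneg (Real.sqrt_nonneg _)]

theorem measurable_pairE {α : Type*} [MeasurableSpace α] {f : α → CVec d} {g : α → ℂ}
    (hf : Measurable f) (hg : Measurable g) : Measurable fun x => pairE (f x) (g x) := by
  unfold pairE pairAbs
  fun_prop

theorem pairE_add_le (v v' : CVec d) (s s' : ℂ) :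
    pairE (v + v') (s + s') ≤ pairE v s + pairE v' s' := by
  simp only [pairE_eq_enorm]
  exact enorm_add_le (WithLp.toLp 2 (v, s)) (WithLp.toLp 2 (v', s'))

theorem pairE_smul (c : ℂ) (v : CVec d) (s : ℂ) : pairE (c • v) (c * s) = ‖c‖ₑ * pairE v s := by
  simp only [pairE_eq_enorm]
  exact enorm_smul c (WithLp.toLp 2 (v, s))

theorem pairE_mono {v v' : CVec d} {s s' : ℂ} (hv : ‖v‖ ≤ ‖v'‖) (hs : ‖s‖ ≤ ‖s'‖) :
    pairE v s ≤ pairE v' s' := by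
  simp only [pairE_eq_ofReal, pairAbs]
  gcongr

/-- The velocity and temperature kernels differ when `ν ≠ μ`; replacing both by the larger one is
the source of the maximum in `ℬ₀`. -/
theorem pairE_smul_le (c c' : ℂ) (v : CVec d) (s : ℂ) :
    pairE (c • v) (c' * s) ≤ max ‖c‖ₑ ‖c'‖ₑ * pairE v s := by
  rcases le_total ‖c‖ ‖c'‖ with h | h
  · calc pairE (c • v) (c' * s) ≤ pairE (c' • v) (c' * s) :=
          pairE_mono (by rw [norm_smul, norm_smul]; gcongr) le_rfl
      _ = ‖c'‖ₑ * pairE v s := pairE_smul _ _ _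
      _ ≤ _ := by gcongr; exact le_max_right _ _
  · calc pairE (c • v) (c' * s) ≤ pairE (c • v) (c * s) :=
          pairE_mono le_rfl (by rw [norm_mul, norm_mul]; gcongr)
      _ = ‖c‖ₑ * pairE v s := pairE_smul _ _ _
      _ ≤ _ := by gcongr; exact le_max_left _ _

theorem pairE_zero_right (v : CVec d) : pairE v 0 = ‖v‖ₑ := by
  rw [pairE_eq_ofReal, pairAbs, norm_zero, zero_pow two_ne_zero, add_zero,
    Real.sqrt_sq (norm_nonneg v), ofReal_norm]

theorem pairE_zero : pairE (0 : CVec d) 0 = 0 := by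
  rw [pairE_zero_right, enorm_zero]

theorem enorm_fst_le_pairE (v : CVec d) (s : ℂ) : ‖v‖ₑ ≤ pairE v s := by
  rw [← pairE_zero_right]
  exact pairE_mono le_rfl (by simp)

theorem enorm_snd_le_pairE (v : CVec d) (s : ℂ) : ‖s‖ₑ ≤ pairE v s := by
  rw [pairE_eq_ofReal, ← ofReal_norm, pairAbs]
  refine ENNReal.ofReal_le_ofReal (Real.le_sqrt_of_sq_le ?_)
  nlinarith [sq_nonneg ‖v‖]

/-- The modulus is the norm of the `L²` product, so this is the triangle inequality for one
vector-valued integral and costs no constant. -/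
theorem pairE_integral_le {α : Type*} [MeasurableSpace α] {m : Measure α} {f : α → CVec d}
    {g : α → ℂ} (hf : Integrable f m) (hg : Integrable g m) :
    pairE (∫ x, f x ∂m) (∫ x, g x ∂m) ≤ ∫⁻ x, pairE (f x) (g x) ∂m := by
  simp only [pairE_eq_enorm]
  have h1 : WithLp.toLp 2 (∫ x, f x ∂m, ∫ x, g x ∂m) = ∫ x, WithLp.toLp 2 (f x, g x) ∂m := by
    rw [← integral_pair hf hg]
    exact ((WithLp.prodContinuousLinearEquiv 2 ℂ (CVec d) ℂ).symm.integral_comp_comm _).symm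
  rw [h1]
  exact enorm_integral_le_lintegral_enorm _

theorem enorm_apply_le (v : CVec d) (j : Fin d) : ‖v j‖ₑ ≤ ‖v‖ₑ := by
  rw [← ofReal_norm, ← ofReal_norm]
  exact ENNReal.ofReal_le_ofReal (PiLp.norm_apply_le v j)

/-- `k ∈ ℝ^d` as a complex vector. -/
noncomputable def waveC (k : Wave d) : CVec d := WithLp.toLp 2 fun i => (k i : ℂ)

theorem norm_waveC (k : Wave d) : ‖waveC k‖ = ‖k‖ := by
  rw [EuclideanSpace.norm_eq, EuclideanSpace.norm_eq]
  simp [waveC]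

theorem inner_waveC (k : Wave d) (v : CVec d) : inner ℂ (waveC k) v = ∑ j, (k j : ℂ) * v j := by
  rw [PiLp.inner_apply]
  simp [waveC, mul_comm]

theorem enorm_sum_mul_le (k : Wave d) (v : CVec d) : ‖∑ j, (k j : ℂ) * v j‖ₑ ≤ ‖k‖ₑ * ‖v‖ₑ := by
  rw [← inner_waveC, ← ofReal_norm, ← ofReal_norm, ← ofReal_norm,
    ← ENNReal.ofReal_mul (norm_nonneg _), ← norm_waveC]
  exact ENNReal.ofReal_le_ofReal (norm_inner_le_norm _ _)

theorem hodge_eq (k : Wave d) (v : CVec d) :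
    hodge k v = v - (inner ℂ (waveC k) v / ((‖k‖ ^ 2 : ℝ) : ℂ)) • waveC k := by
  ext i
  rw [inner_waveC]
  simp only [hodge, waveC, PiLp.sub_apply, PiLp.smul_apply, smul_eq_mul]
  ring

/-- `hodge k v` is orthogonal to the component of `v` along `k`; apply Pythagoras. -/
theorem norm_hodge_le (k : Wave d) (v : CVec d) : ‖hodge k v‖ ≤ ‖v‖ := by
  by_cases hk : k = 0
  · rw [hodge_eq, hk]; simp
  · have hk' : (‖k‖ : ℂ) ≠ 0 := by simpa using hk
    set c := inner ℂ (waveC k) v / ((‖k‖ ^ 2 : ℝ) : ℂ) with hc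
    have horth : inner ℂ (hodge k v) (c • waveC k) = 0 := by
      rw [inner_smul_right, ← inner_conj_symm, hodge_eq, inner_sub_right, inner_smul_right,
        inner_self_eq_norm_sq_to_K, norm_waveC]
      have : inner ℂ (waveC k) v
          - inner ℂ (waveC k) v / ((‖k‖ ^ 2 : ℝ) : ℂ) * (‖k‖ : ℂ) ^ 2 = 0 := by
        push_cast
        field_simp
        ring
      erw [this]
      simp
    have hv : v = hodge k v + c • waveC k := by rw [hodge_eq]; simp [hc]
    have h2 := norm_add_sq_eq_norm_sq_add_norm_sq_of_inner_eq_zero _ _ horth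
    rw [← hv] at h2
    nlinarith [norm_nonneg v, norm_nonneg (hodge k v), norm_nonneg (c • waveC k)]

/-- The Hodge projection as a continuous linear map. -/
noncomputable def hodgeL (k : Wave d) : CVec d →L[ℂ] CVec d :=
  ContinuousLinearMap.id ℂ (CVec d) -
    (((‖k‖ ^ 2 : ℝ) : ℂ)⁻¹ • innerSL ℂ (waveC k)).smulRight (waveC k)

theorem hodgeL_apply (k : Wave d) (v : CVec d) : hodgeL k v = hodge k v := by
  rw [hodge_eq, hodgeL]
  simp [div_eq_inv_mul]

theorem enorm_scaleVec (e : Wave d) (s : ℂ) : ‖scaleVec e s‖ₑ = ‖e‖ₑ * ‖s‖ₑ := by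
  have : scaleVec e s = s • waveC e := by
    ext i; simp [scaleVec, waveC, mul_comm]
  rw [this, enorm_smul, mul_comm, ← ofReal_norm (waveC e), norm_waveC, ofReal_norm]

end Pairs

/-! ### Measurability and integrability of the convolutions -/

section Integrability

variable {d : ℕ} {V : Type*} [NormedAddCommGroup V] [NormedSpace ℂ V]

/-- The convolution of nonnegative functions. -/
noncomputable def conv (f g : Wave d → ℝ≥0∞) (k : Wave d) : ℝ≥0∞ := ∫⁻ q, f q * g (k - q)

theorem enorm_fourierConv_le (f : Wave d → ℂ) (g : Wave d → V) (k : Wave d) :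
    ‖fourierConv f g k‖ₑ ≤ conv (fun q => ‖f q‖ₑ) (fun q => ‖g q‖ₑ) k := by
  refine (enorm_integral_le_lintegral_enorm _).trans (le_of_eq ?_)
  simp only [conv, enorm_smul]

theorem conv_mono {f f' g g' : Wave d → ℝ≥0∞} (hf : ∀ q, f q ≤ f' q) (hg : ∀ q, g q ≤ g' q)
    (k : Wave d) : conv f g k ≤ conv f' g' k :=
  lintegral_mono fun q => mul_le_mul' (hf q) (hg _)

theorem measurable_conv {α : Type*} [MeasurableSpace α] {f g : Wave d → ℝ → ℝ≥0∞}
    (hf : Measurable (Function.uncurry f)) (hg : Measurable (Function.uncurry g))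
    {κ : α → Wave d} {φ ψ : α → ℝ} (hκ : Measurable κ) (hφ : Measurable φ) (hψ : Measurable ψ) :
    Measurable fun x => conv (fun q => f q (φ x)) (fun q => g q (ψ x)) (κ x) := by
  refine Measurable.lintegral_prod_right' (f := fun y : α × Wave d =>
    Function.uncurry f (y.2, φ y.1) * Function.uncurry g (κ y.1 - y.2, ψ y.1)) ?_
  fun_prop

/-- A function of `(k, p)` together with a locally integrable majorant of its norm in `k`. -/
structure IsMajorant (N : FourierNorm) (U : Wave d → ℝ → ℝ≥0∞) (h : ℝ → ℝ≥0∞) : Prop where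
  measurable_fun : Measurable (Function.uncurry U)
  measurable_majorant : Measurable h
  zero_of_nonpos : ∀ p ≤ 0, h p = 0
  lintegral_lt_top : ∀ L, ∫⁻ p in Ioc 0 L, h p < ∞
  enrm_le : ∀ᵐ p, 0 < p → N.enrm (fun k => U k p) ≤ h p

variable {N : FourierNorm} {U : Wave d → ℝ → ℝ≥0∞} {h : ℝ → ℝ≥0∞}

theorem IsMajorant.ae_enrm_conv_le (hU : IsMajorant N U h) (hN : N.Admissible d) (p : ℝ) :
    ∀ᵐ s, s ∈ Ioc 0 p →
      N.enrm (conv (fun q => U q s) (fun q => U q (p - s))) ≤ N.C0 d * (h s * h (p - s)) := by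
  have hq : Measure.QuasiMeasurePreserving (fun s : ℝ => p - s) volume volume :=
    (Measure.measurePreserving_sub_left volume p).quasiMeasurePreserving
  -- The majorant controls only positive times, so the endpoint at which `p - s = 0` is removed.
  have hne : ∀ᵐ s : ℝ, s ≠ p := by simp [ae_iff]
  have hUm := hU.measurable_fun
  filter_upwards [hU.enrm_le, hq.ae hU.enrm_le, hne] with s h1 h2 h3 hs
  refine (FourierNorm.enrm_conv_le hN (hUm.comp (by fun_prop : Measurable fun q => (q, s)))
    (hUm.comp (by fun_prop : Measurable fun q => (q, p - s)))).trans ?_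
  have hlt : s < p := lt_of_le_of_ne hs.2 h3
  gcongr
  · exact h1 hs.1
  · exact h2 (by linarith)

/-- Up to time `L` only the values of `h` on `(0, L]` contribute, and for this integrable piece the
product formula at `ω = 0` bounds the integral by the square of its mass. -/
theorem lintegral_selfConv_lt_top (hm : Measurable h) (h0 : ∀ p ≤ 0, h p = 0)
    (hloc : ∀ L, ∫⁻ p in Ioc 0 L, h p < ∞) (L : ℝ) :
    ∫⁻ p in Ioc 0 L, ∫⁻ s, h s * h (p - s) < ∞ := by
  set f := (Ioc 0 L).indicator h with hf
  have hfm : Measurable f := hm.indicator measurableSet_Ioc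
  have hle : ∀ s ≤ L, h s ≤ f s := fun s hs => by
    rcases le_or_gt s 0 with hs' | hs'
    · rw [h0 s hs']; exact zero_le
    · rw [hf, indicator_of_mem (mem_Ioc.2 ⟨hs', hs⟩)]
  have hone : ∀ p, expWeight 0 p = 1 := fun p => by simp [expWeight]
  have key := lintegral_expWeight_conv 0 hfm hfm
  simp only [hone, one_mul] at key
  have hfi : ∫⁻ p, f p < ∞ := by
    rw [hf, lintegral_indicator measurableSet_Ioc]; exact hloc L
  calc ∫⁻ p in Ioc 0 L, ∫⁻ s, h s * h (p - s) ≤ ∫⁻ p in Ioc 0 L, ∫⁻ s, f s * f (p - s) := by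
        refine setLIntegral_mono' measurableSet_Ioc fun p hp => lintegral_mono fun s => ?_
        rcases le_or_gt s 0 with hs | hs
        · rw [h0 s hs, zero_mul]; exact zero_le
        · rcases le_or_gt s L with hs' | hs'
          · exact mul_le_mul' (hle s hs') (hle _ (by linarith [hp.2]))
          · rw [h0 (p - s) (by linarith [hp.2]), mul_zero]; exact zero_le
    _ ≤ ∫⁻ p, ∫⁻ s, f s * f (p - s) := setLIntegral_le_lintegral _ _
    _ < ∞ := by rw [key]; exact ENNReal.mul_lt_top hfi hfi

theorem IsMajorant.lintegral_conv_le (hU : IsMajorant N U h) (hN : N.Admissible d) (k : Wave d)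
    (p : ℝ) :
    ∫⁻ s in Ioc 0 p, conv (fun q => U q s) (fun q => U q (p - s)) k
      ≤ N.C0 d * ∫⁻ s, h s * h (p - s) := by
  have hm := hU.measurable_majorant
  rw [← lintegral_const_mul _ (by fun_prop)]
  refine le_trans (setLIntegral_mono_ae' measurableSet_Ioc ?_) (setLIntegral_le_lintegral _ _)
  filter_upwards [hU.ae_enrm_conv_le hN p] with s hs hsI
  exact (FourierNorm.le_enrm hN _ k).trans (hs hsI)

theorem IsMajorant.lintegral_lintegral_conv_lt_top (hU : IsMajorant N U h)
    (hN : N.Admissible d) (k : Wave d) (L : ℝ) :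
    ∫⁻ p in Ioc 0 L, ∫⁻ s in Ioc 0 p, conv (fun q => U q s) (fun q => U q (p - s)) k < ∞ := by
  have hm := hU.measurable_majorant
  refine lt_of_le_of_lt (lintegral_mono fun p => hU.lintegral_conv_le hN k p) ?_
  rw [lintegral_const_mul' _ _ (FourierNorm.C0_lt_top hN).ne]
  exact ENNReal.mul_lt_top (FourierNorm.C0_lt_top hN)
    (lintegral_selfConv_lt_top hm hU.zero_of_nonpos hU.lintegral_lt_top L)

theorem IsMajorant.ae_lintegral_conv_lt_top (hU : IsMajorant N U h) (hN : N.Admissible d)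
    (k : Wave d) :
    ∀ᵐ p, ∫⁻ s in Ioc 0 p, conv (fun q => U q s) (fun q => U q (p - s)) k < ∞ := by
  have hm := hU.measurable_majorant
  have hmm : Measurable fun p => ∫⁻ s, h s * h (p - s) :=
    Measurable.lintegral_prod_right' (f := fun x : ℝ × ℝ => h x.2 * h (x.1 - x.2)) (by fun_prop)
  have key : ∀ᵐ p, ∀ n : ℕ, p ∈ Ioc 0 (n : ℝ) → ∫⁻ s, h s * h (p - s) < ∞ := by
    rw [ae_all_iff]
    intro n
    rw [← ae_restrict_iff' measurableSet_Ioc]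
    exact ae_lt_top hmm
      (lintegral_selfConv_lt_top hm hU.zero_of_nonpos hU.lintegral_lt_top n).ne
  filter_upwards [key] with p hp
  rcases le_or_gt p 0 with h' | h'
  · simp [Ioc_eq_empty (not_lt.2 h')]
  · obtain ⟨n, hn⟩ := exists_nat_ge p
    exact (hU.lintegral_conv_le hN k p).trans_lt
      (ENNReal.mul_lt_top (FourierNorm.C0_lt_top hN) (hp n ⟨h', hn⟩))

theorem IsMajorant.integrableOn {E : Type*} [NormedAddCommGroup E] {f : ℝ → E}
    (hU : IsMajorant N U h) (hN : N.Admissible d) (k : Wave d) (hf : StronglyMeasurable f)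
    (hfU : ∀ p, ‖f p‖ₑ ≤ U k p) (L : ℝ) : IntegrableOn f (Ioc 0 L) := by
  refine ⟨hf.aestronglyMeasurable, lt_of_le_of_lt ?_ (hU.lintegral_lt_top L)⟩
  refine setLIntegral_mono_ae' measurableSet_Ioc ?_
  filter_upwards [hU.enrm_le] with p hp hpI
  exact (hfU p).trans ((FourierNorm.le_enrm hN (fun k => U k p) k).trans (hp hpI.1))

variable [MeasurableSpace V] [BorelSpace V] [SecondCountableTopology V]
  {F : Wave d → ℝ → ℂ} {G : Wave d → ℝ → V}

theorem stronglyMeasurable_fourierConv {α : Type*} [MeasurableSpace α]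
    (hF : Measurable (Function.uncurry F)) (hG : Measurable (Function.uncurry G))
    {φ ψ : α → ℝ} (hφ : Measurable φ) (hψ : Measurable ψ) (k : Wave d) :
    StronglyMeasurable fun x : α => fourierConv (fun q => F q (φ x)) (fun q => G q (ψ x)) k := by
  refine StronglyMeasurable.integral_prod_right' (f := fun y : α × Wave d =>
    Function.uncurry F (y.2, φ y.1) • Function.uncurry G (k - y.2, ψ y.1)) ?_
  refine Measurable.stronglyMeasurable ?_
  fun_prop

theorem integrableOn_fourierConv (hF : Measurable (Function.uncurry F))
    (hG : Measurable (Function.uncurry G))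
    (hFU : ∀ k p, ‖F k p‖ₑ ≤ U k p) (hGU : ∀ k p, ‖G k p‖ₑ ≤ U k p) (k : Wave d) {p : ℝ}
    (hp : ∫⁻ s in Ioc 0 p, conv (fun q => U q s) (fun q => U q (p - s)) k < ∞) :
    IntegrableOn (fun s => fourierConv (fun q => F q s) (fun q => G q (p - s)) k) (Ioc 0 p) := by
  refine ⟨(stronglyMeasurable_fourierConv hF hG measurable_id (by fun_prop) k).aestronglyMeasurable,
    lt_of_le_of_lt (lintegral_mono fun s => ?_) hp⟩
  exact (enorm_fourierConv_le _ _ k).trans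
    (conv_mono (fun q => hFU q s) (fun q => hGU q (p - s)) k)

theorem IsMajorant.integrableOn_fourierLaplaceConv (hU : IsMajorant N U h) (hN : N.Admissible d)
    (hF : Measurable (Function.uncurry F)) (hG : Measurable (Function.uncurry G))
    (hFU : ∀ k p, ‖F k p‖ₑ ≤ U k p) (hGU : ∀ k p, ‖G k p‖ₑ ≤ U k p) (k : Wave d) (L : ℝ) :
    IntegrableOn (fourierLaplaceConv F G k) (Ioc 0 L) := by
  have heq : ∀ p ∈ Ioc 0 L, fourierLaplaceConv F G k p = ∫ s in Ioc 0 p,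
      fourierConv (fun q => F q s) (fun q => G q (p - s)) k := fun p hp => by
    rw [fourierLaplaceConv, intervalIntegral.integral_of_le hp.1.le]
  constructor
  · have hm : StronglyMeasurable fun p : ℝ => ∫ s, {x : ℝ × ℝ | 0 < x.2 ∧ x.2 ≤ x.1}.indicator
        (fun x => fourierConv (fun q => F q x.2) (fun q => G q (x.1 - x.2)) k) (p, s) := by
      refine StronglyMeasurable.integral_prod_right' (f :=
        {x : ℝ × ℝ | 0 < x.2 ∧ x.2 ≤ x.1}.indicator
        (fun x => fourierConv (fun q => F q x.2) (fun q => G q (x.1 - x.2)) k)) ?_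
      refine (stronglyMeasurable_fourierConv hF hG measurable_snd (by fun_prop) k).indicator ?_
      exact (measurableSet_lt measurable_const measurable_snd).inter
        (measurableSet_le measurable_snd measurable_fst)
    refine hm.aestronglyMeasurable.congr ?_
    filter_upwards [ae_restrict_mem measurableSet_Ioc] with p hp
    rw [heq p hp, ← integral_indicator measurableSet_Ioc]
    rfl
  · refine lt_of_le_of_lt (setLIntegral_mono' measurableSet_Ioc fun p hp => ?_)
      (hU.lintegral_lintegral_conv_lt_top hN k L)
    rw [heq p hp]
    refine (enorm_integral_le_lintegral_enorm _).trans (lintegral_mono fun s => ?_)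
    exact (enorm_fourierConv_le _ _ k).trans
      (conv_mono (fun q => hFU q s) (fun q => hGU q (p - s)) k)

theorem IsMajorant.integrableOn_fourierConv_left (hU : IsMajorant N U h) (hN : N.Admissible d)
    {f : Wave d → ℂ} (hf : Measurable f) (hG : Measurable (Function.uncurry G))
    {U₀ : Wave d → ℝ≥0∞} (hU₀ : Measurable U₀) (hU₀t : N.enrm U₀ < ∞)
    (hfU : ∀ k, ‖f k‖ₑ ≤ U₀ k) (hGU : ∀ k p, ‖G k p‖ₑ ≤ U k p) (k : Wave d) (L : ℝ) :
    IntegrableOn (fun p => fourierConv f (fun q => G q p) k) (Ioc 0 L) := by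
  have hUm := hU.measurable_fun
  refine ⟨(stronglyMeasurable_fourierConv (F := fun q _ => f q) (by fun_prop) hG measurable_id
    measurable_id k).aestronglyMeasurable, ?_⟩
  refine lt_of_le_of_lt (setLIntegral_mono_ae' (g := fun p => N.C0 d * N.enrm U₀ * h p)
    measurableSet_Ioc ?_) ?_
  · filter_upwards [hU.enrm_le] with p hp hpI
    refine (enorm_fourierConv_le _ _ k).trans
      ((conv_mono hfU (fun q => hGU q p) k).trans ((FourierNorm.le_enrm hN _ k).trans ?_))
    refine (FourierNorm.enrm_conv_le hN hU₀
      (hUm.comp (by fun_prop : Measurable fun q => (q, p)))).trans ?_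
    rw [mul_assoc]
    gcongr
    exact hp hpI.1
  · have hc : N.C0 d * N.enrm U₀ < ∞ := ENNReal.mul_lt_top (FourierNorm.C0_lt_top hN) hU₀t
    rw [lintegral_const_mul' _ _ hc.ne]
    exact ENNReal.mul_lt_top hc (hU.lintegral_lt_top L)

theorem IsMajorant.integrableOn_fourierConv_right (hU : IsMajorant N U h) (hN : N.Admissible d)
    {g : Wave d → V} (hF : Measurable (Function.uncurry F)) (hg : Measurable g)
    {U₀ : Wave d → ℝ≥0∞} (hU₀ : Measurable U₀) (hU₀t : N.enrm U₀ < ∞)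
    (hFU : ∀ k p, ‖F k p‖ₑ ≤ U k p) (hgU : ∀ k, ‖g k‖ₑ ≤ U₀ k) (k : Wave d) (L : ℝ) :
    IntegrableOn (fun p => fourierConv (fun q => F q p) g k) (Ioc 0 L) := by
  have hUm := hU.measurable_fun
  refine ⟨(stronglyMeasurable_fourierConv (G := fun q _ => g q) hF (by fun_prop) measurable_id
    measurable_id k).aestronglyMeasurable, ?_⟩
  refine lt_of_le_of_lt (setLIntegral_mono_ae' (g := fun p => N.C0 d * N.enrm U₀ * h p)
    measurableSet_Ioc ?_) ?_
  · filter_upwards [hU.enrm_le] with p hp hpI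
    refine (enorm_fourierConv_le _ _ k).trans
      ((conv_mono (fun q => hFU q p) hgU k).trans ((FourierNorm.le_enrm hN _ k).trans ?_))
    refine (FourierNorm.enrm_conv_le hN
      (hUm.comp (by fun_prop : Measurable fun q => (q, p))) hU₀).trans ?_
    rw [mul_assoc, mul_comm (N.enrm U₀)]
    gcongr
    exact hp hpI.1
  · have hc : N.C0 d * N.enrm U₀ < ∞ := ENNReal.mul_lt_top (FourierNorm.C0_lt_top hN) hU₀t
    rw [lintegral_const_mul' _ _ hc.ne]
    exact ENNReal.mul_lt_top hc (hU.lintegral_lt_top L)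

end Integrability

/-! ### The nonlinearity and its truncation -/

section Truncation

variable {d : ℕ} {V : Type*}

/-- The part of `F` on `p > p₀`. -/
noncomputable def tail [Zero V] (p₀ : ℝ) (F : Wave d → ℝ → V) : Wave d → ℝ → V :=
  fun k => (Ioi p₀).indicator (F k)

theorem tail_of_lt [Zero V] {p₀ p : ℝ} (h : p₀ < p) (F : Wave d → ℝ → V) (k : Wave d) :
    tail p₀ F k p = F k p := indicator_of_mem (mem_Ioi.2 h) _

theorem tail_of_le [Zero V] {p₀ p : ℝ} (h : p ≤ p₀) (F : Wave d → ℝ → V) (k : Wave d) :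
    tail p₀ F k p = 0 := indicator_of_notMem (by simpa using h) _

theorem known_of_mem [Zero V] {p₀ p : ℝ} (h : p ∈ Ioc 0 p₀) (F : Wave d → ℝ → V) (k : Wave d) :
    known p₀ F k p = F k p := indicator_of_mem h _

theorem known_of_lt [Zero V] {p₀ p : ℝ} (h : p₀ < p) (F : Wave d → ℝ → V) (k : Wave d) :
    known p₀ F k p = 0 := indicator_of_notMem (fun h' => h'.2.not_gt h) _

theorem known_coord (p₀ : ℝ) (H : Wave d → ℝ → CVec d) (k : Wave d) (p : ℝ) (j : Fin d) :
    known p₀ H k p j = known p₀ (fun q s => H q s j) k p := by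
  by_cases h : p ∈ Ioc 0 p₀ <;> simp [known, h]

theorem enorm_known_le [NormedAddCommGroup V] (p₀ : ℝ) (F : Wave d → ℝ → V) (k : Wave d) (p : ℝ) :
    ‖known p₀ F k p‖ₑ ≤ ‖F k p‖ₑ := by
  by_cases h : p ∈ Ioc 0 p₀ <;> simp [known, h]

theorem measurable_known [Zero V] [MeasurableSpace V] (p₀ : ℝ) {F : Wave d → ℝ → V}
    (hF : Measurable (Function.uncurry F)) : Measurable (Function.uncurry (known p₀ F)) := by
  have : Function.uncurry (known p₀ F)
      = {x : Wave d × ℝ | x.2 ∈ Ioc 0 p₀}.indicator (Function.uncurry F) := by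
    ext ⟨k, p⟩
    rfl
  rw [this]
  exact hF.indicator (measurable_snd measurableSet_Ioc)

theorem measurable_tail [Zero V] [MeasurableSpace V] (p₀ : ℝ) {F : Wave d → ℝ → V}
    (hF : Measurable (Function.uncurry F)) : Measurable (Function.uncurry (tail p₀ F)) := by
  have : Function.uncurry (tail p₀ F)
      = {x : Wave d × ℝ | x.2 ∈ Ioi p₀}.indicator (Function.uncurry F) := by
    ext ⟨k, p⟩
    rfl
  rw [this]
  exact hF.indicator (measurable_snd measurableSet_Ioi)

theorem pairE_tail (p₀ : ℝ) (H : Wave d → ℝ → CVec d) (S : Wave d → ℝ → ℂ) (k : Wave d) (p : ℝ) :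
    pairE (tail p₀ H k p) (tail p₀ S k p) = tail p₀ (fun k p => pairE (H k p) (S k p)) k p := by
  rcases le_or_gt p p₀ with h | h
  · simp only [tail_of_le h, pairE_zero]
  · simp only [tail_of_lt h]

variable [NormedAddCommGroup V] [NormedSpace ℂ V]

theorem fourierConv_zero_left (g : Wave d → V) (k : Wave d) : fourierConv (fun _ => 0) g k = 0 := by
  simp [fourierConv]

theorem fourierConv_zero_right (f : Wave d → ℂ) (k : Wave d) :
    fourierConv f (fun _ => (0 : V)) k = 0 := by
  simp [fourierConv]

/-- The nonlinear term `u_{0,j} * W + H_j * w₀ + H_j ** W`. -/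
noncomputable def nonlin (u₀ : Wave d → CVec d) (w₀ : Wave d → V) (H : Wave d → ℝ → CVec d)
    (W : Wave d → ℝ → V) (j : Fin d) (k : Wave d) (p : ℝ) : V :=
  fourierConv (fun q => u₀ q j) (fun q => W q p) k + fourierConv (fun q => H q p j) w₀ k
    + fourierLaplaceConv (fun q s => H q s j) W k p

/-- The times `s` at which one of `s`, `p - s` exceeds `p₀`. -/
def lateTimes (p₀ p : ℝ) : Set ℝ := {s | p₀ < s ∨ p₀ < p - s}

theorem measurableSet_lateTimes (p₀ p : ℝ) : MeasurableSet (lateTimes p₀ p) :=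
  (measurableSet_lt measurable_const measurable_id).union
    (measurableSet_lt measurable_const (measurable_const.sub measurable_id))

/-- The part of the convolution `F ** W` that involves times beyond `p₀`. -/
noncomputable def tailConv (p₀ : ℝ) (F : Wave d → ℝ → ℂ) (W : Wave d → ℝ → V) (k : Wave d)
    (p : ℝ) : V :=
  ∫ s in Ioc 0 p, (lateTimes p₀ p).indicator
    (fun s => fourierConv (fun q => F q s) (fun q => W q (p - s)) k) s

theorem fourierConv_known {p₀ s t : ℝ} (hs : 0 < s) (ht : 0 < t) (F : Wave d → ℝ → ℂ)
    (W : Wave d → ℝ → V) (k : Wave d) :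
    fourierConv (fun q => known p₀ F q s) (fun q => known p₀ W q t) k
      = if p₀ < s ∨ p₀ < t then 0 else fourierConv (fun q => F q s) (fun q => W q t) k := by
  split_ifs with h
  · rcases h with h | h
    · simp only [known_of_lt h, fourierConv_zero_left]
    · simp only [known_of_lt h, fourierConv_zero_right]
  · push Not at h
    simp only [known_of_mem (⟨hs, h.1⟩ : s ∈ Ioc 0 p₀), known_of_mem (⟨ht, h.2⟩ : t ∈ Ioc 0 p₀)]

/-- The truncated convolution is the full one restricted to the `s` with both `s` and `p - s` at
most `p₀`; subtraction leaves exactly `lateTimes`. Integrability is needed to subtract the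
integrals. -/
theorem fourierLaplaceConv_sub_known {p₀ p : ℝ} (hp : 0 < p) {F : Wave d → ℝ → ℂ}
    {W : Wave d → ℝ → V} {k : Wave d} (hInt : IntegrableOn
      (fun s => fourierConv (fun q => F q s) (fun q => W q (p - s)) k) (Ioc 0 p)) :
    fourierLaplaceConv F W k p - fourierLaplaceConv (known p₀ F) (known p₀ W) k p
      = tailConv p₀ F W k p := by
  have hne : ∀ᵐ s : ℝ, s ≠ p := by simp [ae_iff]
  have h2 : fourierLaplaceConv (known p₀ F) (known p₀ W) k p = ∫ s in Ioc 0 p,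
      (lateTimes p₀ p)ᶜ.indicator
        (fun s => fourierConv (fun q => F q s) (fun q => W q (p - s)) k) s := by
    rw [fourierLaplaceConv, intervalIntegral.integral_of_le hp.le]
    refine setIntegral_congr_ae measurableSet_Ioc ?_
    filter_upwards [hne] with s hs hsI
    rw [fourierConv_known hsI.1 (by linarith [lt_of_le_of_ne hsI.2 hs])]
    by_cases h : s ∈ lateTimes p₀ p
    · rw [indicator_of_notMem (by simpa using h), if_pos (show p₀ < s ∨ p₀ < p - s from h)]
    · rw [indicator_of_mem (by simpa using h), if_neg (show ¬(p₀ < s ∨ p₀ < p - s) from h)]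
  rw [h2, fourierLaplaceConv, intervalIntegral.integral_of_le hp.le, tailConv,
    ← integral_sub hInt (hInt.indicator (measurableSet_lateTimes p₀ p).compl)]
  refine integral_congr_ae (ae_of_all _ fun s => ?_)
  by_cases h : s ∈ lateTimes p₀ p <;> simp [h]

theorem nonlin_sub_known {p₀ p : ℝ} (hp : 0 < p) {u₀ : Wave d → CVec d} {w₀ : Wave d → V}
    {H : Wave d → ℝ → CVec d} {W : Wave d → ℝ → V} {j : Fin d} {k : Wave d}
    (hInt : IntegrableOn
      (fun s => fourierConv (fun q => H q s j) (fun q => W q (p - s)) k) (Ioc 0 p)) :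
    nonlin u₀ w₀ H W j k p - nonlin u₀ w₀ (known p₀ H) (known p₀ W) j k p
      = fourierConv (fun q => u₀ q j) (fun q => tail p₀ W q p) k
        + fourierConv (fun q => tail p₀ H q p j) w₀ k + tailConv p₀ (fun q s => H q s j) W k p := by
  rw [← fourierLaplaceConv_sub_known hp hInt]
  simp only [nonlin, known_coord]
  rcases le_or_gt p p₀ with h | h
  · have hm : p ∈ Ioc 0 p₀ := ⟨hp, h⟩
    simp only [known_of_mem hm, tail_of_le h, fourierConv_zero_right]
    simp only [PiLp.zero_apply, fourierConv_zero_left]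
    abel
  · simp only [known_of_lt h, tail_of_lt h, fourierConv_zero_right, fourierConv_zero_left]
    abel

/-- If `s + t > 2p₀`, one of the two times exceeds `p₀`. Hence the cut at `min p (2 * p₀)` in `(Ĥ,
Ŝ)^{(s)}` loses nothing. -/
theorem nonlin_known_eq_zero {p₀ p : ℝ} (hp₀ : 0 < p₀) (hp : 2 * p₀ < p) (u₀ : Wave d → CVec d)
    (w₀ : Wave d → V) (H : Wave d → ℝ → CVec d) (W : Wave d → ℝ → V) (j : Fin d) (k : Wave d) :
    nonlin u₀ w₀ (known p₀ H) (known p₀ W) j k p = 0 := by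
  have h : p₀ < p := by linarith
  have hLC : fourierLaplaceConv (known p₀ fun q s => H q s j) (known p₀ W) k p = 0 := by
    rw [fourierLaplaceConv, intervalIntegral.integral_of_le (by linarith)]
    refine setIntegral_eq_zero_of_forall_eq_zero fun s _ => ?_
    rcases lt_or_ge p₀ s with hs | hs
    · simp only [known_of_lt hs, fourierConv_zero_left]
    · simp only [known_of_lt (show p₀ < p - s by linarith), fourierConv_zero_right]
  simp only [nonlin, known_coord, hLC]
  simp only [known_of_lt h, fourierConv_zero_right, fourierConv_zero_left, add_zero]

end Truncation

/-! ### Bounds for the nonlinearity -/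

section Bounds

variable {d : ℕ}

theorem sum_smul_integral {ι α E : Type*} [Fintype ι] [MeasurableSpace α] [NormedAddCommGroup E]
    [NormedSpace ℂ E] {m : Measure α} (c : ι → ℂ) {f : ι → α → E}
    (hf : ∀ j, Integrable (f j) m) :
    Integrable (fun x => ∑ j, c j • f j x) m ∧
      ∑ j, c j • ∫ x, f j x ∂m = ∫ x, ∑ j, c j • f j x ∂m := by
  have h : ∀ j ∈ Finset.univ, Integrable (fun x => c j • f j x) m := fun j _ => (hf j).smul (c j)
  refine ⟨integrable_finsetSum _ h, ?_⟩
  rw [integral_finsetSum _ h]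
  simp only [integral_smul]

theorem pairE_sum_integral_le {ι α : Type*} [Fintype ι] [MeasurableSpace α] {m : Measure α}
    (c : ι → ℂ) {f : ι → α → CVec d} {g : ι → α → ℂ} (hf : ∀ j, Integrable (f j) m)
    (hg : ∀ j, Integrable (g j) m) :
    pairE (∑ j, c j • ∫ x, f j x ∂m) (∑ j, c j • ∫ x, g j x ∂m)
      ≤ ∫⁻ x, pairE (∑ j, c j • f j x) (∑ j, c j • g j x) ∂m := by
  rw [(sum_smul_integral c hf).2, (sum_smul_integral c hg).2]
  exact pairE_integral_le (sum_smul_integral c hf).1 (sum_smul_integral c hg).1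

/-- Summing over `j` before taking moduli produces the scalar `k · f(q)`, common to both components;
Cauchy–Schwarz then gives `|k| |f(q)|` with no dimensional factor. -/
theorem pairE_sum_fourierConv_le {f : Wave d → CVec d} {g : Wave d → CVec d} {g' : Wave d → ℂ}
    (hf : Measurable f) (hg : Measurable g) (hg' : Measurable g') (k : Wave d) :
    pairE (∑ j, (k j : ℂ) • fourierConv (fun q => f q j) g k)
        (∑ j, (k j : ℂ) • fourierConv (fun q => f q j) g' k)
      ≤ ‖k‖ₑ * conv (fun q => ‖f q‖ₑ) (fun q => pairE (g q) (g' q)) k := by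
  by_cases hk : k = 0
  · simp [hk, pairE_zero]
  -- For an infinite convolution the bound is trivial, since `k ≠ 0`; otherwise the integrals
  -- converge absolutely and may be combined.
  by_cases hfin : conv (fun q => ‖f q‖ₑ) (fun q => pairE (g q) (g' q)) k = ∞
  · rw [hfin, ENNReal.mul_top (by simpa using hk)]
    exact le_top
  have hi : ∀ j, Integrable fun q => f q j • g (k - q) := fun j => by
    refine ⟨Measurable.aestronglyMeasurable (by fun_prop),
      lt_of_le_of_lt (lintegral_mono fun q => ?_) (lt_top_iff_ne_top.2 hfin)⟩
    rw [enorm_smul]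
    exact mul_le_mul' (enorm_apply_le _ _) (enorm_fst_le_pairE _ _)
  have hi' : ∀ j, Integrable fun q => f q j • g' (k - q) := fun j => by
    refine ⟨Measurable.aestronglyMeasurable (by fun_prop),
      lt_of_le_of_lt (lintegral_mono fun q => ?_) (lt_top_iff_ne_top.2 hfin)⟩
    rw [enorm_smul]
    exact mul_le_mul' (enorm_apply_le _ _) (enorm_snd_le_pairE _ _)
  refine (pairE_sum_integral_le (fun j => (k j : ℂ)) hi hi').trans ?_
  rw [conv, ← lintegral_const_mul' _ _ enorm_ne_top]
  refine lintegral_mono fun q => ?_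
  simp only [smul_smul, ← Finset.sum_smul]
  rw [smul_eq_mul, pairE_smul, ← mul_assoc]
  gcongr
  exact enorm_sum_mul_le k (f q)

/-- The majorant of the difference of the nonlinearity and its truncation. -/
noncomputable def tailMajorant (p₀ : ℝ) (U₀ : Wave d → ℝ≥0∞) (U : Wave d → ℝ → ℝ≥0∞) (k : Wave d)
    (p : ℝ) : ℝ≥0∞ :=
  conv U₀ (fun q => tail p₀ U q p) k + conv (fun q => tail p₀ U q p) U₀ k
    + ∫⁻ s in Ioc 0 p, (lateTimes p₀ p).indicator
        (fun s => conv (fun q => U q s) (fun q => U q (p - s)) k) s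

/-- Causality: up to `p₀` the nonlinearity and its truncation agree. This confines the kernel to `p₀
< p'` in the final estimate. -/
theorem tailMajorant_eq_zero {p₀ p : ℝ} (hp : p ≤ p₀) (U₀ : Wave d → ℝ≥0∞)
    (U : Wave d → ℝ → ℝ≥0∞) (k : Wave d) : tailMajorant p₀ U₀ U k p = 0 := by
  have h : ∫⁻ s in Ioc 0 p, (lateTimes p₀ p).indicator
      (fun s => conv (fun q => U q s) (fun q => U q (p - s)) k) s = 0 := by
    rw [setLIntegral_congr_fun (g := fun _ => 0) measurableSet_Ioc, lintegral_zero]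
    intro s hs
    refine indicator_of_notMem (fun h => ?_) _
    rcases h with h | h
    · linarith [hs.2]
    · linarith [hs.1]
  simp only [tailMajorant, h, tail_of_le hp]
  simp [conv]

variable {H : Wave d → ℝ → CVec d} {S : Wave d → ℝ → ℂ} {u₀ : Wave d → CVec d} {Θ₀ : Wave d → ℂ}

/-- The difference has three parts: initial data against the tail, tail against initial data, and
the late part of the quadratic convolution. `pairE_sum_fourierConv_le` applies to each, under the
`s`-integral for the third. -/
theorem pairE_sum_nonlin_sub_known_le (hH : Measurable (Function.uncurry H))
    (hS : Measurable (Function.uncurry S)) (hu₀ : Measurable u₀) (hΘ₀ : Measurable Θ₀)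
    (p₀ : ℝ) {p : ℝ} (hp : 0 < p) (k : Wave d)
    (hfin : ∫⁻ s in Ioc 0 p, conv (fun q => pairE (H q s) (S q s))
      (fun q => pairE (H q (p - s)) (S q (p - s))) k < ∞) :
    pairE (∑ j, (k j : ℂ) •
        (nonlin u₀ u₀ H H j k p - nonlin u₀ u₀ (known p₀ H) (known p₀ H) j k p))
      (∑ j, (k j : ℂ) •
        (nonlin u₀ Θ₀ H S j k p - nonlin u₀ Θ₀ (known p₀ H) (known p₀ S) j k p))
      ≤ ‖k‖ₑ * tailMajorant p₀ (fun k => pairE (u₀ k) (Θ₀ k)) (fun k p => pairE (H k p) (S k p))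
          k p := by
  have hHj : ∀ j, Measurable (Function.uncurry fun q s => H q s j) := fun j =>
    (PiLp.continuous_apply 2 _ j).measurable.comp hH
  have hHU : ∀ j k p, ‖H k p j‖ₑ ≤ pairE (H k p) (S k p) := fun j k p =>
    (enorm_apply_le _ _).trans (enorm_fst_le_pairE _ _)
  have hslice : ∀ {X : Type} [MeasurableSpace X] {F : Wave d → ℝ → X},
      Measurable (Function.uncurry F) → ∀ t, Measurable fun q => F q t := fun hF t =>
    hF.comp (by fun_prop : Measurable fun q => (q, t))
  have hi1 : ∀ j, IntegrableOn
      (fun s => fourierConv (fun q => H q s j) (fun q => H q (p - s)) k) (Ioc 0 p) := fun j =>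
    integrableOn_fourierConv (U := fun k p => pairE (H k p) (S k p)) (hHj j) hH (hHU j)
      (fun k p => enorm_fst_le_pairE _ _) k hfin
  have hi2 : ∀ j, IntegrableOn
      (fun s => fourierConv (fun q => H q s j) (fun q => S q (p - s)) k) (Ioc 0 p) := fun j =>
    integrableOn_fourierConv (U := fun k p => pairE (H k p) (S k p)) (hHj j) hS (hHU j)
      (fun k p => enorm_snd_le_pairE _ _) k hfin
  simp only [nonlin_sub_known hp (hi1 _), nonlin_sub_known hp (hi2 _), smul_add,
    Finset.sum_add_distrib]
  refine (pairE_add_le _ _ _ _).trans ?_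
  rw [tailMajorant, mul_add, mul_add]
  refine add_le_add ((pairE_add_le _ _ _ _).trans (add_le_add ?_ ?_)) ?_
  · refine (pairE_sum_fourierConv_le hu₀ (hslice (measurable_tail p₀ hH) p)
      (hslice (measurable_tail p₀ hS) p) k).trans ?_
    gcongr
    exact conv_mono (fun q => enorm_fst_le_pairE _ _) (fun q => (pairE_tail p₀ H S q p).le) k
  · refine (pairE_sum_fourierConv_le (hslice (measurable_tail p₀ hH) p) hu₀ hΘ₀ k).trans ?_
    gcongr
    refine conv_mono (fun q => ?_) (fun q => le_rfl) k
    rw [← pairE_tail]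
    exact enorm_fst_le_pairE _ _
  · have hE := measurableSet_lateTimes p₀ p
    refine (pairE_sum_integral_le (fun j => (k j : ℂ)) (fun j => (hi1 j).indicator hE)
      (fun j => (hi2 j).indicator hE)).trans ?_
    rw [← lintegral_const_mul' _ _ enorm_ne_top]
    refine lintegral_mono fun s => ?_
    by_cases hs : s ∈ lateTimes p₀ p
    · simp only [indicator_of_mem hs]
      refine (pairE_sum_fourierConv_le (hslice hH s) (hslice hH (p - s))
        (hslice hS (p - s)) k).trans ?_
      gcongr
      exact conv_mono (fun q => enorm_fst_le_pairE _ _) (fun q => le_rfl) k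
    · simp [indicator_of_notMem hs, pairE_zero]

end Bounds

/-! ### The difference of the solution and its known part -/

section Difference

variable {d : ℕ} {V : Type*} [NormedAddCommGroup V] [NormedSpace ℂ V]

theorem integrableOn_kernel_smul {κ : ℝ} (hκ : 0 < κ) (k : Wave d) {p : ℝ} (hp : 0 < p)
    {f : ℝ → V} (hf : IntegrableOn f (Ioc 0 p)) :
    IntegrableOn (fun p' => (borelKernel κ k p p' : ℂ) • f p') (Ioc 0 p) := by
  have hK : AEStronglyMeasurable (fun p' => (borelKernel κ k p p' : ℂ))
      (volume.restrict (Ioc 0 p)) :=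
    ((Complex.continuous_ofReal.comp_continuousOn (continuousOn_borelKernel hκ k hp)).mono
      Ioc_subset_Ioi_self).aestronglyMeasurable measurableSet_Ioc
  refine Integrable.mono' (hf.norm.const_mul (max 1 |wronskian 1|)) (hK.smul hf.1) ?_
  filter_upwards [ae_restrict_mem measurableSet_Ioc] with p' hp'
  rw [norm_smul, Complex.norm_real, Real.norm_eq_abs]
  gcongr
  exact abs_borelKernel_le hκ k hp'.1 hp'.2

theorem intervalIntegral_eq_setIntegral_Ioc {f : ℝ → V} {m p : ℝ} (hm : 0 ≤ m) (hmp : m ≤ p)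
    (hf : ∀ x ∈ Ioc m p, f x = 0) : ∫ x in (0 : ℝ)..m, f x = ∫ x in Ioc 0 p, f x := by
  rw [intervalIntegral.integral_of_le hm]
  refine (setIntegral_eq_of_subset_of_forall_sdiff_eq_zero measurableSet_Ioc
    (Ioc_subset_Ioc_right hmp) fun x hx => hf x ⟨?_, hx.1.2⟩).symm
  by_contra! h
  exact hx.2 ⟨hx.1.1, h⟩

variable [MeasurableSpace V] [BorelSpace V] [SecondCountableTopology V]
  {N : FourierNorm} {U : Wave d → ℝ → ℝ≥0∞} {h : ℝ → ℝ≥0∞} {U₀ : Wave d → ℝ≥0∞}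
  {u₀ : Wave d → CVec d} {w₀ : Wave d → V} {H : Wave d → ℝ → CVec d} {W : Wave d → ℝ → V}

theorem measurable_coord (hH : Measurable (Function.uncurry H)) (j : Fin d) :
    Measurable (Function.uncurry fun q s => H q s j) :=
  (PiLp.continuous_apply 2 _ j).measurable.comp hH

theorem IsMajorant.integrableOn_nonlin (hU : IsMajorant N U h) (hN : N.Admissible d)
    (hU₀ : Measurable U₀) (hU₀t : N.enrm U₀ < ∞) (hu₀ : Measurable u₀) (hw₀ : Measurable w₀)
    (hH : Measurable (Function.uncurry H)) (hW : Measurable (Function.uncurry W))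
    (hu₀U : ∀ k, ‖u₀ k‖ₑ ≤ U₀ k) (hw₀U : ∀ k, ‖w₀ k‖ₑ ≤ U₀ k)
    (hHU : ∀ k p, ‖H k p‖ₑ ≤ U k p) (hWU : ∀ k p, ‖W k p‖ₑ ≤ U k p)
    (j : Fin d) (k : Wave d) (L : ℝ) : IntegrableOn (nonlin u₀ w₀ H W j k) (Ioc 0 L) := by
  have hHj := measurable_coord hH j
  have hHjU : ∀ k p, ‖H k p j‖ₑ ≤ U k p := fun k p => (enorm_apply_le _ _).trans (hHU k p)
  exact ((hU.integrableOn_fourierConv_left hN (by fun_prop) hW hU₀ hU₀t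
    (fun k => (enorm_apply_le _ _).trans (hu₀U k)) hWU k L).add
    (hU.integrableOn_fourierConv_right hN hHj hw₀ hU₀ hU₀t hHjU hw₀U k L)).add
    (hU.integrableOn_fourierLaplaceConv hN hHj hW hHjU hWU k L)

/-- The convective part of the integral equation minus its truncation, as one integral. -/
theorem IsMajorant.convective_sub_known (hU : IsMajorant N U h) (hN : N.Admissible d)
    (hU₀ : Measurable U₀) (hU₀t : N.enrm U₀ < ∞) (hu₀ : Measurable u₀) (hw₀ : Measurable w₀)
    (hH : Measurable (Function.uncurry H)) (hW : Measurable (Function.uncurry W))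
    (hu₀U : ∀ k, ‖u₀ k‖ₑ ≤ U₀ k) (hw₀U : ∀ k, ‖w₀ k‖ₑ ≤ U₀ k)
    (hHU : ∀ k p, ‖H k p‖ₑ ≤ U k p) (hWU : ∀ k p, ‖W k p‖ₑ ≤ U k p)
    (P : V →L[ℂ] V) {κ : ℝ} (hκ : 0 < κ) {p₀ p : ℝ} (hp₀ : 0 < p₀) (hp : p₀ < p) (k : Wave d) :
    IntegrableOn (fun p' => (borelKernel κ k p p' : ℂ) • -(Complex.I • P (∑ j, (k j : ℂ) •
        (nonlin u₀ w₀ H W j k p' - nonlin u₀ w₀ (known p₀ H) (known p₀ W) j k p')))) (Ioc 0 p) ∧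
    (∑ j, (Complex.I * (k j : ℂ)) • ∫ p' in (0 : ℝ)..p,
        (borelKernel κ k p p' : ℂ) • -P (nonlin u₀ w₀ H W j k p'))
      - (∑ j, (Complex.I * (k j : ℂ)) • ∫ p' in (0 : ℝ)..min p (2 * p₀),
        (borelKernel κ k p p' : ℂ) • -P (nonlin u₀ w₀ (known p₀ H) (known p₀ W) j k p'))
      = ∫ p' in Ioc 0 p, (borelKernel κ k p p' : ℂ) • -(Complex.I • P (∑ j, (k j : ℂ) •
        (nonlin u₀ w₀ H W j k p' - nonlin u₀ w₀ (known p₀ H) (known p₀ W) j k p'))) := by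
  have hp0 : 0 < p := hp₀.trans hp
  have hi1 : ∀ j, IntegrableOn (fun p' => (borelKernel κ k p p' : ℂ) •
      -P (nonlin u₀ w₀ H W j k p')) (Ioc 0 p) := fun j =>
    integrableOn_kernel_smul hκ k hp0 (P.integrable_comp (hU.integrableOn_nonlin hN hU₀ hU₀t hu₀
      hw₀ hH hW hu₀U hw₀U hHU hWU j k p)).neg
  have hi2 : ∀ j, IntegrableOn (fun p' => (borelKernel κ k p p' : ℂ) •
      -P (nonlin u₀ w₀ (known p₀ H) (known p₀ W) j k p')) (Ioc 0 p) := fun j =>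
    integrableOn_kernel_smul hκ k hp0 (P.integrable_comp (hU.integrableOn_nonlin hN hU₀ hU₀t hu₀
      hw₀ (measurable_known p₀ hH) (measurable_known p₀ hW) hu₀U hw₀U
      (fun k p => (enorm_known_le _ _ _ _).trans (hHU k p))
      (fun k p => (enorm_known_le _ _ _ _).trans (hWU k p)) j k p)).neg
  have hmin : ∀ j, ∫ p' in (0 : ℝ)..min p (2 * p₀), (borelKernel κ k p p' : ℂ) •
      -P (nonlin u₀ w₀ (known p₀ H) (known p₀ W) j k p') = ∫ p' in Ioc 0 p,
        (borelKernel κ k p p' : ℂ) • -P (nonlin u₀ w₀ (known p₀ H) (known p₀ W) j k p') :=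
    fun j => intervalIntegral_eq_setIntegral_Ioc (by positivity) (min_le_left _ _) fun x hx => by
      have : 2 * p₀ < x := by
        rcases min_lt_iff.1 hx.1 with h' | h'
        · exact absurd hx.2 (not_le.2 h')
        · exact h'
      rw [nonlin_known_eq_zero hp₀ this]
      simp
  have hd : ∀ j, IntegrableOn (fun p' => (borelKernel κ k p p' : ℂ) •
      -P (nonlin u₀ w₀ H W j k p') - (borelKernel κ k p p' : ℂ) •
      -P (nonlin u₀ w₀ (known p₀ H) (known p₀ W) j k p')) (Ioc 0 p) := fun j =>
    (hi1 j).sub (hi2 j)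
  have hpt : ∀ p', (borelKernel κ k p p' : ℂ) • -(Complex.I • P (∑ j, (k j : ℂ) •
        (nonlin u₀ w₀ H W j k p' - nonlin u₀ w₀ (known p₀ H) (known p₀ W) j k p')))
      = ∑ j, (Complex.I * (k j : ℂ)) • ((borelKernel κ k p p' : ℂ) •
      -P (nonlin u₀ w₀ H W j k p') - (borelKernel κ k p p' : ℂ) •
      -P (nonlin u₀ w₀ (known p₀ H) (known p₀ W) j k p')) := fun p' => by
    rw [map_sum, Finset.smul_sum, ← Finset.sum_neg_distrib, Finset.smul_sum]
    refine Finset.sum_congr rfl fun j _ => ?_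
    rw [map_smul, map_sub]
    module
  simp only [hpt]
  refine ⟨(sum_smul_integral _ hd).1, ?_⟩
  rw [← (sum_smul_integral _ hd).2, ← Finset.sum_sub_distrib]
  refine Finset.sum_congr rfl fun j _ => ?_
  rw [hmin, intervalIntegral.integral_of_le hp0.le, ← smul_sub, ← integral_sub (hi1 j) (hi2 j)]

end Difference

section Solution

variable {d : ℕ} {N : FourierNorm} {D : Data d} {H : Wave d → ℝ → CVec d} {S : Wave d → ℝ → ℂ}
  {h : ℝ → ℝ≥0∞}

/-- The buoyancy term minus its truncation. -/
theorem IsMajorant.buoyancy_sub_known (hU : IsMajorant N (fun k p => pairE (H k p) (S k p)) h)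
    (hN : N.Admissible d) (hS : Measurable (Function.uncurry S)) (e : Wave d) {κ : ℝ} (hκ : 0 < κ)
    {p₀ p : ℝ} (hp₀ : 0 < p₀) (hp : p₀ < p) (k : Wave d) :
    IntegrableOn (fun p' => (borelKernel κ k p p' : ℂ) • hodge k (scaleVec e (tail p₀ S k p')))
      (Ioc 0 p) ∧
    (∫ p' in (0 : ℝ)..p, (borelKernel κ k p p' : ℂ) • hodge k (scaleVec e (S k p')))
      - (∫ p' in (0 : ℝ)..min p p₀,
          (borelKernel κ k p p' : ℂ) • hodge k (scaleVec e (known p₀ S k p')))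
      = ∫ p' in Ioc 0 p, (borelKernel κ k p p' : ℂ) • hodge k (scaleVec e (tail p₀ S k p')) := by
  have hp0 : 0 < p := hp₀.trans hp
  have hsc : ∀ s : ℂ, hodge k (scaleVec e s) = s • hodge k (waveC e) := fun s => by
    rw [← hodgeL_apply, ← hodgeL_apply, ← map_smul]
    congr 1
    ext i
    simp [scaleVec, waveC, mul_comm]
  have aux : ∀ {T : Wave d → ℝ → ℂ}, Measurable (Function.uncurry T) →
      (∀ p, ‖T k p‖ₑ ≤ ‖S k p‖ₑ) → IntegrableOn
        (fun p' => (borelKernel κ k p p' : ℂ) • hodge k (scaleVec e (T k p'))) (Ioc 0 p) := by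
    intro T hT hTS
    have hTk : Measurable (T k) := hT.comp (by fun_prop : Measurable fun p : ℝ => (k, p))
    have := hU.integrableOn hN k hTk.stronglyMeasurable
      (fun p => (hTS p).trans (enorm_snd_le_pairE _ _)) p
    refine integrableOn_kernel_smul hκ k hp0 ?_
    simp only [hsc]
    exact this.smul_const _
  have hz : hodge k (scaleVec e 0) = 0 := by rw [hsc, zero_smul]
  have hi1 := aux hS fun _ => le_rfl
  have hi2 := aux (measurable_known p₀ hS) fun p => enorm_known_le _ _ _ _
  have hmin : ∫ p' in (0 : ℝ)..min p p₀,
      (borelKernel κ k p p' : ℂ) • hodge k (scaleVec e (known p₀ S k p')) = ∫ p' in Ioc 0 p,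
      (borelKernel κ k p p' : ℂ) • hodge k (scaleVec e (known p₀ S k p')) :=
    intervalIntegral_eq_setIntegral_Ioc (by positivity) (min_le_left _ _) fun x hx => by
      have : p₀ < x := by
        rcases min_lt_iff.1 hx.1 with h' | h'
        · exact absurd hx.2 (not_le.2 h')
        · exact h'
      rw [known_of_lt this, hz, smul_zero]
  refine ⟨aux (measurable_tail p₀ hS) fun p => ?_, ?_⟩
  · rcases le_or_gt p p₀ with h' | h'
    · simp [tail_of_le h']
    · simp [tail_of_lt h']
  rw [hmin, intervalIntegral.integral_of_le hp0.le, ← integral_sub hi1 hi2]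
  refine setIntegral_congr_fun measurableSet_Ioc fun x hx => ?_
  rcases le_or_gt x p₀ with h' | h'
  · simp only [known_of_mem (⟨hx.1, h'⟩ : x ∈ Ioc 0 p₀), tail_of_le h', hz, sub_self, smul_zero]
  · simp only [known_of_lt h', tail_of_lt h', hz, sub_zero, smul_zero]

/-- The pointwise bound of `(Ĥ, Ŝ) - (Ĥ, Ŝ)^{(s)}` beyond `p₀`. -/
theorem IsMajorant.pairE_rhs_sub_le (hU : IsMajorant N (fun k p => pairE (H k p) (S k p)) h)
    (hN : N.Admissible d) (hν : 0 < D.ν) (hμ : 0 < D.μ) (ha : 0 ≤ D.a) (he : ‖D.e‖ = 1)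
    (hu0 : Measurable D.u0) (hΘ0 : Measurable D.Θ0)
    (hdata : N.enrm (fun k => pairE (D.u0 k) (D.Θ0 k)) < ∞)
    (hH : Measurable (Function.uncurry H)) (hS : Measurable (Function.uncurry S))
    {p₀ p : ℝ} (hp₀ : 0 < p₀) (hp : p₀ < p) (k : Wave d) :
    pairE (velocityRHS D H S p p k p - Hs D H S p₀ k p)
        (temperatureRHS D H S p k p - Ss D H S p₀ k p)
      ≤ ∫⁻ p' in Ioc p₀ p,
        ((⨆ k : Wave d, ‖k‖ₑ * kernelSup D p₀ k) * tailMajorant p₀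
          (fun k => pairE (D.u0 k) (D.Θ0 k)) (fun k p => pairE (H k p) (S k p)) k p'
        + (ENNReal.ofReal D.a * ⨆ k : Wave d, kernelSup D p₀ k) * pairE (H k p') (S k p')) := by
  have hU₀ : Measurable fun k => pairE (D.u0 k) (D.Θ0 k) := measurable_pairE hu0 hΘ0
  obtain ⟨hiv, hv⟩ := hU.convective_sub_known hN hU₀ hdata hu0 hu0 hH hH
    (fun k => enorm_fst_le_pairE _ _) (fun k => enorm_fst_le_pairE _ _)
    (fun k p => enorm_fst_le_pairE _ _) (fun k p => enorm_fst_le_pairE _ _) (hodgeL k) hν hp₀ hp k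
  obtain ⟨hit, ht⟩ := hU.convective_sub_known hN hU₀ hdata hu0 hΘ0 hH hS
    (fun k => enorm_fst_le_pairE _ _) (fun k => enorm_snd_le_pairE _ _)
    (fun k p => enorm_fst_le_pairE _ _) (fun k p => enorm_snd_le_pairE _ _)
    (ContinuousLinearMap.id ℂ ℂ) hμ hp₀ hp k
  obtain ⟨hib, hb⟩ := hU.buoyancy_sub_known hN hS D.e hν hp₀ hp k
  simp only [hodgeL_apply] at hv hiv
  simp only [ContinuousLinearMap.id_apply] at ht hit
  set ΔH : ℝ → CVec d := fun p' => ∑ j, (k j : ℂ) • (nonlin D.u0 D.u0 H H j k p'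
    - nonlin D.u0 D.u0 (known p₀ H) (known p₀ H) j k p') with hΔH
  set ΔS : ℝ → ℂ := fun p' => ∑ j, (k j : ℂ) • (nonlin D.u0 D.Θ0 H S j k p'
    - nonlin D.u0 D.Θ0 (known p₀ H) (known p₀ S) j k p') with hΔS
  have hib' : IntegrableOn (fun p' => (D.a : ℂ) • (borelKernel D.ν k p p' : ℂ) •
      hodge k (scaleVec D.e (tail p₀ S k p'))) (Ioc 0 p) := hib.smul (D.a : ℂ)
  replace hiv : IntegrableOn (fun p' => (borelKernel D.ν k p p' : ℂ) •
      -(Complex.I • hodge k (ΔH p'))) (Ioc 0 p) := hiv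
  -- The source terms with `u1` are identical on both sides and cancel.
  have hV : velocityRHS D H S p p k p - Hs D H S p₀ k p = ∫ p' in Ioc 0 p,
      ((borelKernel D.ν k p p' : ℂ) • -(Complex.I • hodge k (ΔH p')) + (D.a : ℂ) •
        (borelKernel D.ν k p p' : ℂ) • hodge k (scaleVec D.e (tail p₀ S k p'))) := by
    rw [integral_add hiv hib', integral_smul, ← hb]
    simp only [hΔH]
    rw [← hv]
    simp only [velocityRHS, Hs]
    simp only [show ∀ (H : Wave d → ℝ → CVec d) j p', G1 D H j k p'
      = -hodge k (nonlin D.u0 D.u0 H H j k p') from fun _ _ _ => rfl]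
    rw [smul_sub]
    abel
  have hT : temperatureRHS D H S p k p - Ss D H S p₀ k p = ∫ p' in Ioc 0 p,
      (borelKernel D.μ k p p' : ℂ) • -(Complex.I • ΔS p') := by
    rw [← ht]
    simp only [temperatureRHS, Ss]
    simp only [show ∀ (H : Wave d → ℝ → CVec d) (S : Wave d → ℝ → ℂ) j p', G2 D H S j k p'
      = -nonlin D.u0 D.Θ0 H S j k p' from fun _ _ _ _ => rfl, smul_eq_mul]
    abel
  rw [hV, hT]
  refine (pairE_integral_le (hiv.add hib') hit).trans ?_
  have hsplit : ∀ f : ℝ → ℝ≥0∞, ∫⁻ p' in Ioc p₀ p, f p'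
      = ∫⁻ p' in Ioc 0 p, (Ioc p₀ p).indicator f p' := fun f => by
    rw [lintegral_indicator measurableSet_Ioc, Measure.restrict_restrict measurableSet_Ioc,
      inter_eq_left.2 (Ioc_subset_Ioc_left hp₀.le)]
  rw [hsplit]
  refine setLIntegral_mono_ae' measurableSet_Ioc ?_
  filter_upwards [hU.ae_lintegral_conv_lt_top hN k] with p' hfin hp'
  have hΔ : pairE (ΔH p') (ΔS p') ≤ _ :=
    pairE_sum_nonlin_sub_known_le hH hS hu0 hΘ0 p₀ hp'.1 k hfin
  have hΔ' : pairE (-(Complex.I • hodge k (ΔH p'))) (-(Complex.I • ΔS p'))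
      ≤ pairE (ΔH p') (ΔS p') := by
    refine pairE_mono ?_ ?_
    · rw [norm_neg, norm_smul, Complex.norm_I, one_mul]; exact norm_hodge_le _ _
    · rw [norm_neg, norm_smul, Complex.norm_I, one_mul]
  have hbuoy : ‖(D.a : ℂ) • (borelKernel D.ν k p p' : ℂ) • hodge k (scaleVec D.e (tail p₀ S k p'))‖ₑ
      ≤ ENNReal.ofReal D.a * (‖borelKernel D.ν k p p'‖ₑ * ‖tail p₀ S k p'‖ₑ) := by
    have e1 : ‖(D.a : ℂ)‖ₑ = ENNReal.ofReal D.a := by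
      rw [← ofReal_norm, Complex.norm_real, Real.norm_of_nonneg ha]
    have e2 : ‖(borelKernel D.ν k p p' : ℂ)‖ₑ = ‖borelKernel D.ν k p p'‖ₑ := by
      rw [← ofReal_norm, Complex.norm_real, ofReal_norm]
    rw [enorm_smul, enorm_smul, e1, e2]
    gcongr
    calc ‖hodge k (scaleVec D.e (tail p₀ S k p'))‖ₑ ≤ ‖scaleVec D.e (tail p₀ S k p')‖ₑ :=
          enorm_le_iff_norm_le.2 (norm_hodge_le _ _)
      _ = _ := by
          rw [enorm_scaleVec, ← ofReal_norm D.e, he, ENNReal.ofReal_one, one_mul]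
  have hsum : pairE ((borelKernel D.ν k p p' : ℂ) • -(Complex.I • hodge k (ΔH p')) + (D.a : ℂ) •
        (borelKernel D.ν k p p' : ℂ) • hodge k (scaleVec D.e (tail p₀ S k p')))
        ((borelKernel D.μ k p p' : ℂ) • -(Complex.I • ΔS p'))
      ≤ max ‖borelKernel D.ν k p p'‖ₑ ‖borelKernel D.μ k p p'‖ₑ * (‖k‖ₑ * tailMajorant p₀
          (fun k => pairE (D.u0 k) (D.Θ0 k)) (fun k p => pairE (H k p) (S k p)) k p')
        + ENNReal.ofReal D.a * (‖borelKernel D.ν k p p'‖ₑ * ‖tail p₀ S k p'‖ₑ) := by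
    have e2 : ∀ κ, ‖(borelKernel κ k p p' : ℂ)‖ₑ = ‖borelKernel κ k p p'‖ₑ := fun κ => by
      rw [← ofReal_norm, Complex.norm_real, ofReal_norm]
    calc _ ≤ pairE ((borelKernel D.ν k p p' : ℂ) • -(Complex.I • hodge k (ΔH p')))
          ((borelKernel D.μ k p p' : ℂ) • -(Complex.I • ΔS p')) + pairE ((D.a : ℂ) •
        (borelKernel D.ν k p p' : ℂ) • hodge k (scaleVec D.e (tail p₀ S k p'))) 0 := by
          have := pairE_add_le ((borelKernel D.ν k p p' : ℂ) • -(Complex.I • hodge k (ΔH p')))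
            ((D.a : ℂ) • (borelKernel D.ν k p p' : ℂ) • hodge k (scaleVec D.e (tail p₀ S k p')))
            ((borelKernel D.μ k p p' : ℂ) • -(Complex.I • ΔS p')) 0
          rwa [add_zero] at this
      _ ≤ _ := by
          rw [pairE_zero_right]
          refine add_le_add ((pairE_smul_le _ _ _ _).trans ?_) hbuoy
          rw [e2, e2]
          exact mul_le_mul_right (hΔ'.trans hΔ) _
  refine hsum.trans ?_
  -- Before `p₀` both contributions vanish; after it the kernel lies in the range of the supremum
  -- `kernelSup`.
  rcases le_or_gt p' p₀ with h' | h'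
  · rw [tailMajorant_eq_zero h', tail_of_le h']
    simp
  · rw [indicator_of_mem (mem_Ioc.2 ⟨h', hp'.2⟩), tail_of_lt h']
    have hK := le_kernelSup D k h'.le hp'.2
    refine add_le_add ?_ ?_
    · rw [← mul_assoc]
      refine mul_le_mul_left ?_ _
      rw [mul_comm]
      exact (mul_le_mul_right hK _).trans (le_iSup (fun k : Wave d => ‖k‖ₑ * kernelSup D p₀ k) k)
    · rw [mul_assoc]
      refine mul_le_mul_right (mul_le_mul' ?_ (enorm_snd_le_pairE _ _)) _
      exact (le_max_left _ _).trans (hK.trans (le_iSup (kernelSup D p₀) k))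

end Solution

/-! ### The Volterra inequality for the norm of the solution -/

section Volterra

variable {d : ℕ} {N : FourierNorm} {U : Wave d → ℝ → ℝ≥0∞} {h : ℝ → ℝ≥0∞} {U₀ : Wave d → ℝ≥0∞}

theorem measurable_lateConv (p₀ : ℝ) (hU : Measurable (Function.uncurry U)) :
    Measurable fun x : (Wave d × ℝ) × ℝ => (lateTimes p₀ x.1.2).indicator
      (fun s => conv (fun q => U q s) (fun q => U q (x.1.2 - s)) x.1.1) x.2 := by
  have hm : Measurable fun x : (Wave d × ℝ) × ℝ =>
      conv (fun q => U q x.2) (fun q => U q (x.1.2 - x.2)) x.1.1 :=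
    measurable_conv hU hU (by fun_prop) (by fun_prop) (by fun_prop)
  exact hm.indicator (s := {x : (Wave d × ℝ) × ℝ | p₀ < x.2 ∨ p₀ < x.1.2 - x.2})
    ((measurableSet_lt measurable_const measurable_snd).union
      (measurableSet_lt measurable_const
        ((measurable_snd.comp measurable_fst).sub measurable_snd)))

theorem measurable_setLIntegral_lateConv (p₀ : ℝ) (hU : Measurable (Function.uncurry U)) :
    Measurable fun x : Wave d × ℝ => ∫⁻ s in Ioc 0 x.2, (lateTimes p₀ x.2).indicator
      (fun s => conv (fun q => U q s) (fun q => U q (x.2 - s)) x.1) s := by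
  simp only [← lintegral_indicator (measurableSet_Ioc (α := ℝ))]
  refine Measurable.lintegral_prod_right' (f :=
    {y : (Wave d × ℝ) × ℝ | 0 < y.2 ∧ y.2 ≤ y.1.2}.indicator
    fun y => (lateTimes p₀ y.1.2).indicator
      (fun s => conv (fun q => U q s) (fun q => U q (y.1.2 - s)) y.1.1) y.2) ?_
  exact (measurable_lateConv p₀ hU).indicator
    ((measurableSet_lt measurable_const measurable_snd).inter
      (measurableSet_le measurable_snd (by fun_prop)))

theorem measurable_tailMajorant (p₀ : ℝ) (hU₀ : Measurable U₀)
    (hU : Measurable (Function.uncurry U)) :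
    Measurable (Function.uncurry (tailMajorant p₀ U₀ U)) := by
  have hU₀' : Measurable (Function.uncurry fun (q : Wave d) (_ : ℝ) => U₀ q) := by fun_prop
  have h1 : Measurable fun x : Wave d × ℝ => conv U₀ (fun q => tail p₀ U q x.2) x.1 :=
    measurable_conv hU₀' (measurable_tail p₀ hU) measurable_fst measurable_snd measurable_snd
  have h2 : Measurable fun x : Wave d × ℝ => conv (fun q => tail p₀ U q x.2) U₀ x.1 :=
    measurable_conv (measurable_tail p₀ hU) hU₀' measurable_fst measurable_snd measurable_snd
  exact (h1.add h2).add (measurable_setLIntegral_lateConv p₀ hU)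

/-- Of the four early/late combinations only early–early is excluded at a late time; the other three
are the convolutions in `volterra`. -/
theorem mul_le_of_mem_lateTimes (h : ℝ → ℝ≥0∞) {p₀ p s : ℝ} (hs : s ∈ lateTimes p₀ p) :
    h s * h (p - s) ≤ (Iic p₀).indicator h s * (Ioi p₀).indicator h (p - s)
      + (Ioi p₀).indicator h s * (Iic p₀).indicator h (p - s)
      + (Ioi p₀).indicator h s * (Ioi p₀).indicator h (p - s) := by
  rcases le_or_gt s p₀ with h1 | h1
  · have h2 : p₀ < p - s := hs.resolve_left (not_lt.2 h1)
    rw [indicator_of_mem (mem_Iic.2 h1), indicator_of_mem (mem_Ioi.2 h2), add_assoc]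
    exact le_self_add
  · rcases le_or_gt (p - s) p₀ with h2 | h2
    · rw [indicator_of_mem (mem_Ioi.2 h1), indicator_of_mem (mem_Iic.2 h2), add_right_comm]
      exact le_add_self
    · rw [indicator_of_mem (mem_Ioi.2 h1), indicator_of_mem (mem_Ioi.2 h2)]
      exact le_add_self

theorem IsMajorant.ae_enrm_tailMajorant_le (hU : IsMajorant N U h) (hN : N.Admissible d)
    (hU₀ : Measurable U₀) {p₀ : ℝ} (hp₀ : 0 < p₀) :
    ∀ᵐ p, p₀ < p → N.enrm (fun k => tailMajorant p₀ U₀ U k p) ≤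
      N.C0 d * volterra (2 * N.enrm U₀) 1 ((Iic p₀).indicator h) ((Ioi p₀).indicator h) p := by
  have hm := hU.measurable_majorant
  have hUm := hU.measurable_fun
  have hg : Measurable ((Iic p₀).indicator h) := hm.indicator measurableSet_Iic
  have hf : Measurable ((Ioi p₀).indicator h) := hm.indicator measurableSet_Ioi
  filter_upwards [hU.enrm_le] with p hp hpp
  have hp0 : 0 < p := hp₀.trans hpp
  have hUp : Measurable fun q => U q p := hUm.comp (by fun_prop : Measurable fun q => (q, p))
  have hk : ∀ t : ℝ, Measurable fun k : Wave d => (k, t) := fun t => by fun_prop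
  have m3 : Measurable fun k => ∫⁻ s in Ioc 0 p, (lateTimes p₀ p).indicator
      (fun s => conv (fun q => U q s) (fun q => U q (p - s)) k) s :=
    (measurable_setLIntegral_lateConv p₀ hUm).comp (hk p)
  have m2 : Measurable fun k => conv (fun q => U q p) U₀ k :=
    (measurable_conv (f := U) (g := fun q _ => U₀ q) hUm (by fun_prop) measurable_fst
      measurable_snd measurable_snd).comp (hk p)
  have b3 : N.enrm (fun k => ∫⁻ s in Ioc 0 p, (lateTimes p₀ p).indicator
      (fun s => conv (fun q => U q s) (fun q => U q (p - s)) k) s) ≤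
      N.C0 d * ∫⁻ s, ((Iic p₀).indicator h s * (Ioi p₀).indicator h (p - s)
      + (Ioi p₀).indicator h s * (Iic p₀).indicator h (p - s)
      + (Ioi p₀).indicator h s * (Ioi p₀).indicator h (p - s)) := by
    have hmm : Measurable (Function.uncurry fun (k : Wave d) (s : ℝ) =>
        (lateTimes p₀ p).indicator
          (fun s => conv (fun q => U q s) (fun q => U q (p - s)) k) s) :=
      (measurable_lateConv p₀ hUm).comp
        (by fun_prop : Measurable fun x : Wave d × ℝ => ((x.1, p), x.2))
    refine (FourierNorm.enrm_lintegral_le _ hmm).trans ?_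
    rw [← lintegral_const_mul _ (by fun_prop)]
    refine le_trans (setLIntegral_mono_ae' measurableSet_Ioc ?_) (setLIntegral_le_lintegral _ _)
    filter_upwards [hU.ae_enrm_conv_le hN p] with s hs hsI
    by_cases hL : s ∈ lateTimes p₀ p
    · simp only [indicator_of_mem hL]
      refine (hs hsI).trans ?_
      gcongr
      exact mul_le_of_mem_lateTimes h hL
    · simp only [indicator_of_notMem hL]
      -- The norm of the zero function is shown to vanish by writing it as a multiple by `0`.
      refine le_trans (FourierNorm.enrm_mono (g := fun _ => 0 * 0) (by simp)) ?_
      refine (FourierNorm.enrm_const_mul_le 0 measurable_const).trans ?_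
      rw [zero_mul]
      exact zero_le
  simp only [tailMajorant, tail_of_lt hpp]
  refine (FourierNorm.enrm_add_le _ m3).trans ?_
  refine (add_le_add ((FourierNorm.enrm_add_le _ m2).trans
    (add_le_add (FourierNorm.enrm_conv_le hN hU₀ hUp)
      (FourierNorm.enrm_conv_le hN hUp hU₀))) b3).trans ?_
  rw [volterra, one_mul, mul_add, lintegral_add_left (by fun_prop),
    lintegral_add_left (by fun_prop), indicator_of_mem (mem_Ioi.2 hpp)]
  refine add_le_add ?_ le_rfl
  calc N.C0 d * (N.enrm U₀ * N.enrm fun q => U q p) + N.C0 d * ((N.enrm fun q => U q p) * N.enrm U₀)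
      = N.C0 d * (2 * N.enrm U₀ * N.enrm fun q => U q p) := by ring
    _ ≤ _ := by
        gcongr
        exact hp hp0

theorem IsMajorant.ae_enrm_source_le (hU : IsMajorant N U h) (hN : N.Admissible d)
    (hU₀ : Measurable U₀) {p₀ : ℝ} (hp₀ : 0 < p₀) (K₃ : ℝ≥0∞) {K₄ B₄ : ℝ≥0∞} (hK : K₄ ≤ B₄) :
    ∀ᵐ p, p₀ < p → N.enrm (fun k => K₃ * tailMajorant p₀ U₀ U k p + K₄ * U k p) ≤
      volterra (2 * (N.C0 d * K₃) * N.enrm U₀ + B₄) (N.C0 d * K₃) ((Iic p₀).indicator h)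
        ((Ioi p₀).indicator h) p := by
  have hUm := hU.measurable_fun
  have hTm := measurable_tailMajorant p₀ hU₀ hUm
  filter_upwards [hU.ae_enrm_tailMajorant_le hN hU₀ hp₀, hU.enrm_le] with p hT hh hp
  have hUp : Measurable fun k => U k p := hUm.of_uncurry_right
  have hTp : Measurable fun k => tailMajorant p₀ U₀ U k p :=
    hTm.of_uncurry_right
  refine (FourierNorm.enrm_add_le _ (hUp.const_mul _)).trans ?_
  refine (add_le_add ((FourierNorm.enrm_const_mul_le _ hTp).trans
    (mul_le_mul_right (hT hp) _)) ((FourierNorm.enrm_const_mul_le _ hUp).trans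
    (mul_le_mul' hK (hh (hp₀.trans hp))))).trans (le_of_eq ?_)
  rw [volterra, volterra, indicator_of_mem (mem_Ioi.2 hp)]
  ring

variable {D : Data d} {H : Wave d → ℝ → CVec d} {S : Wave d → ℝ → ℂ}

theorem B1_eq (N : FourierNorm) (D : Data d) (p₀ : ℝ) :
    B1 N D p₀ = 2 * B3 N D p₀ * N.enrm (fun k => pairE (D.u0 k) (D.Θ0 k)) := by
  rw [B1, B3, FourierNorm.nrm_eq_enrm]
  simp only [pairE]

/-- The pointwise comparison `IsMajorant.pairE_rhs_sub_le` is passed through the norm by Minkowski's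
inequality, and the algebra property turns convolutions in `k` into products of norms. -/
theorem IsMajorant.ae_le_add_volterra (hd : d = 2 ∨ d = 3)
    (hU : IsMajorant N (fun k p => pairE (H k p) (S k p)) h)
    (hN : N.Admissible d) (hν : 0 < D.ν) (hμ : 0 < D.μ) (ha : 0 ≤ D.a) (he : ‖D.e‖ = 1)
    (hu0 : Measurable D.u0) (hΘ0 : Measurable D.Θ0)
    (hdata : N.enrm (fun k => pairE (D.u0 k) (D.Θ0 k)) < ∞) (hsol : IsSolution D N H S)
    {p₀ : ℝ} (hp₀ : 0 < p₀) :
    ∀ᵐ p, p₀ < p → N.enrm (fun k => pairE (H k p) (S k p)) ≤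
      N.enrm (fun k => pairE (Hs D H S p₀ k p) (Ss D H S p₀ k p))
      + ∫⁻ p' in Ioc p₀ p, volterra (B1 N D p₀ + B4 N D p₀) (B3 N D p₀) ((Iic p₀).indicator h)
          ((Ioi p₀).indicator h) p' := by
  have hU₀ : Measurable fun k => pairE (D.u0 k) (D.Θ0 k) := measurable_pairE hu0 hΘ0
  have hUm := hU.measurable_fun
  have hv := (ae_restrict_iff' measurableSet_Ioi).1 hsol.velocity_eq
  have ht := (ae_restrict_iff' measurableSet_Ioi).1 hsol.temperature_eq
  set K₃ := ⨆ k : Wave d, ‖k‖ₑ * kernelSup D p₀ k with hK₃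
  set K₄ := ⨆ k : Wave d, kernelSup D p₀ k with hK₄
  have hB3 : B3 N D p₀ = N.C0 d * K₃ := B3_eq D N
  have hB4 : ENNReal.ofReal D.a * K₄ ≤ B4 N D p₀ := by
    rw [B4_eq D N, mul_left_comm]
    exact le_mul_of_one_le_left zero_le (FourierNorm.one_le_C0 hd hN)
  have hB1 := B1_eq N D p₀
  set Φ : Wave d → ℝ → ℝ≥0∞ := fun k p' => K₃ * tailMajorant p₀
    (fun k => pairE (D.u0 k) (D.Θ0 k)) (fun k p => pairE (H k p) (S k p)) k p'
      + (ENNReal.ofReal D.a * K₄) * pairE (H k p') (S k p') with hΦ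
  have hTm := measurable_tailMajorant p₀ hU₀ hUm
  have hΦm : Measurable (Function.uncurry Φ) := (hTm.const_mul K₃).add (hUm.const_mul _)
  filter_upwards [hv, ht] with p hvp htp hp
  have hp0 : 0 < p := hp₀.trans hp
  have hle : ∀ k, pairE (H k p) (S k p) ≤ pairE (Hs D H S p₀ k p) (Ss D H S p₀ k p)
      + ∫⁻ p' in Ioc p₀ p, Φ k p' := fun k => by
    have h1 := hU.pairE_rhs_sub_le hN hν hμ ha he hu0 hΘ0 hdata hsol.measurable_H
      hsol.measurable_S hp₀ hp k
    rw [← hvp hp0 k, ← htp hp0 k] at h1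
    have h2 := pairE_add_le (Hs D H S p₀ k p) (H k p - Hs D H S p₀ k p) (Ss D H S p₀ k p)
      (S k p - Ss D H S p₀ k p)
    rw [add_sub_cancel, add_sub_cancel] at h2
    exact h2.trans (add_le_add le_rfl h1)
  have hRm : Measurable fun k => ∫⁻ p' in Ioc p₀ p, Φ k p' := hΦm.lintegral_prod_right'
  refine (FourierNorm.enrm_mono hle).trans ((FourierNorm.enrm_add_le _ hRm).trans
    (add_le_add le_rfl ((FourierNorm.enrm_lintegral_le _ hΦm).trans ?_)))
  refine setLIntegral_mono_ae' measurableSet_Ioc ?_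
  filter_upwards [hU.ae_enrm_source_le hN hU₀ hp₀ K₃ hB4] with p' hT hp'
  rw [hB1, hB3]
  exact hT hp'.1

/-- `ω ↦ ω e^{-ωp}` decreases once `ωp ≥ 1`. Concretely, `ω₀p ≥ 1` gives `ω ≤ ω₀ (1 + (ω - ω₀)p) ≤
ω₀ e^{(ω - ω₀)p}`. -/
theorem mul_expWeight_le {ω₀ ω p₀ p : ℝ} (hω₀ : 0 ≤ ω₀) (hω : ω₀ ≤ ω)
    (hmono : ω = ω₀ ∨ 1 ≤ ω₀ * p₀) (hp : p₀ < p) :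
    ENNReal.ofReal ω * expWeight ω p ≤ ENNReal.ofReal ω₀ * expWeight ω₀ p := by
  rcases hmono with rfl | h1
  · exact le_rfl
  have h2 : 1 ≤ ω₀ * p := h1.trans (by gcongr)
  rw [expWeight, expWeight, ← ENNReal.ofReal_mul (hω₀.trans hω), ← ENNReal.ofReal_mul hω₀]
  refine ENNReal.ofReal_le_ofReal ?_
  have h3 : Real.exp (-ω₀ * p) = Real.exp (-ω * p) * Real.exp ((ω - ω₀) * p) := by
    rw [← Real.exp_add]; congr 1; ring
  have h4 := Real.add_one_le_exp ((ω - ω₀) * p)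
  rw [h3]
  calc ω * Real.exp (-ω * p) ≤ (ω₀ * Real.exp ((ω - ω₀) * p)) * Real.exp (-ω * p) := by
        gcongr
        have h5 : ω₀ * ((ω - ω₀) * p + 1) ≤ ω₀ * Real.exp ((ω - ω₀) * p) := by gcongr
        nlinarith
    _ = _ := by ring

end Volterra

end Boussinesq

/-! ### Proof of the exponential estimate -/

theorem theorem4 {d : ℕ} (hd : d = 2 ∨ d = 3)
    (N : Boussinesq.FourierNorm) (hN : N.Admissible d)
    (D : Boussinesq.Data d) (hν : 0 < D.ν) (hμ : 0 < D.μ) (ha : 0 ≤ D.a) (he : ‖D.e‖ = 1)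
    (hu0_meas : Measurable D.u0) (hΘ0_meas : Measurable D.Θ0) (hf_meas : Measurable D.f)
    (hdata : N.nrm (fun k => (1 + ‖k‖) ^ 2 * Boussinesq.pairAbs (D.u0 k) (D.Θ0 k)) < ∞)
    (hf : N.nrm (fun k => ‖D.f k‖) < ∞)
    (H : Boussinesq.Wave d → ℝ → Boussinesq.CVec d) (S : Boussinesq.Wave d → ℝ → ℂ)
    (hsol : Boussinesq.IsSolution D N H S)
    (p₀ : ℝ) (hp₀ : 0 < p₀) (ω₀ ω : ℝ) (hω₀ : 0 ≤ ω₀) (hω : ω₀ ≤ ω)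
    (hmono : ω = ω₀ ∨ 1 ≤ ω₀ * p₀)
    (hlt : Boussinesq.ε₁ N D H S p₀ ω₀
        + 2 * (Boussinesq.B3 N D p₀ * Boussinesq.b N D H S p₀ ω₀) ^ (1 / 2 : ℝ)
      < ENNReal.ofReal ω) :
    ∫⁻ p in Ioi (0 : ℝ), ENNReal.ofReal (Real.exp (-ω * p)) *
      N.nrm (fun k => Boussinesq.pairAbs (H k p) (S k p)) < ∞ := by
  open Boussinesq in
  have hωpos : 0 < ω := by
    by_contra! h'
    rw [ENNReal.ofReal_of_nonpos h'] at hlt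
    exact not_lt_zero hlt
  have hdata' : N.enrm (fun k => pairE (D.u0 k) (D.Θ0 k)) < ∞ := by
    rw [FourierNorm.nrm_eq_enrm] at hdata
    refine lt_of_le_of_lt (FourierNorm.enrm_mono fun k => ?_) hdata
    rw [enorm_mul]
    refine le_mul_of_one_le_left zero_le ?_
    rw [Real.enorm_of_nonneg (by positivity), ENNReal.one_le_ofReal]
    exact one_le_pow₀ (by linarith [norm_nonneg k])
  -- a measurable version of the norm of the solution
  set g := hsol.aemeasurable_norm.mk with hg
  have hgm : Measurable g := hsol.aemeasurable_norm.measurable_mk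
  have hgae : ∀ᵐ p, 0 < p → N.nrm (fun k => pairAbs (H k p) (S k p)) = g p :=
    (ae_restrict_iff' measurableSet_Ioi).1 hsol.aemeasurable_norm.ae_eq_mk
  set h : ℝ → ℝ≥0∞ := (Ioi 0).indicator g with hh
  have hhae : ∀ᵐ p, 0 < p → N.nrm (fun k => pairAbs (H k p) (S k p)) = h p := by
    filter_upwards [hgae] with p hp hp0
    rw [hp hp0, hh, indicator_of_mem (mem_Ioi.2 hp0)]
  have hloc : ∀ L, ∫⁻ p in Ioc 0 L, h p < ∞ := fun L => by
    refine lt_of_eq_of_lt (setLIntegral_congr_fun_ae measurableSet_Ioc ?_)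
      (hsol.locallyIntegrable L)
    filter_upwards [hhae] with p hp hpI
    exact (hp hpI.1).symm
  have h0 : ∀ p ≤ 0, h p = 0 := fun p hp => indicator_of_notMem (by simpa using hp) _
  have hhm : Measurable h := hgm.indicator measurableSet_Ioi
  have hU : IsMajorant N (fun k p => pairE (H k p) (S k p)) h :=
    ⟨measurable_pairE hsol.measurable_H hsol.measurable_S, hhm, h0, hloc, by
      filter_upwards [hhae] with p hp hp0
      rw [← hp hp0, FourierNorm.nrm_eq_enrm]
      rfl⟩
  have hineq := hU.ae_le_add_volterra hd hN hν hμ ha he hu0_meas hΘ0_meas hdata' hsol hp₀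
  have hB3pos : 0 < B3 N D p₀ := by
    rw [B3_eq]
    exact ENNReal.mul_pos (one_pos.trans_le (FourierNorm.one_le_C0 hd hN)).ne'
      (iSup_norm_mul_kernelSup_pos hν hp₀ he).ne'
  have hB3top : B3 N D p₀ < ∞ := by
    rw [B3_eq]
    exact ENNReal.mul_lt_top (FourierNorm.C0_lt_top hN) (iSup_norm_mul_kernelSup_lt_top hν hμ hp₀)
  -- The integral defining `ε₁` has the weight `e^{-ω₀p}`, which dominates `e^{-ωp}` for positive
  -- `p`.
  have hε : B1 N D p₀ + B4 N D p₀
      + 2 * B3 N D p₀ * ∫⁻ p, expWeight ω p * (Iic p₀).indicator h p ≤ ε₁ N D H S p₀ ω₀ := by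
    rw [ε₁]
    refine add_le_add le_rfl ?_
    rw [← lintegral_const_mul' _ _ (ENNReal.mul_ne_top (by simp) hB3top.ne),
      ← lintegral_indicator measurableSet_Ioc]
    refine lintegral_mono_ae ?_
    filter_upwards [hhae] with p hp
    rcases le_or_gt p 0 with hp0 | hp0
    · have : (Iic p₀).indicator h p = 0 := by
        rw [indicator_of_mem (mem_Iic.2 (hp0.trans hp₀.le)), h0 p hp0]
      simp [this]
    · rcases le_or_gt p p₀ with hpp | hpp
      · have hm : p ∈ Ioc 0 p₀ := ⟨hp0, hpp⟩
        rw [indicator_of_mem (mem_Iic.2 hpp), indicator_of_mem hm, B2, ← hp hp0]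
        simp only [known_of_mem hm]
        rw [mul_left_comm]
        refine mul_le_mul' ?_ le_rfl
        refine ENNReal.ofReal_le_ofReal (Real.exp_le_exp.2 ?_)
        nlinarith
      · simp [indicator_of_notMem (show p ∉ Iic p₀ by simpa using hpp)]
  -- Here the prefactor `ω` grows while the weight decays; `ω = ω₀` or `ω₀p₀ ≥ 1` makes the decay
  -- win for every `p > p₀`.
  have hb : ENNReal.ofReal ω * ∫⁻ p in Ioi p₀, expWeight ω p *
      N.enrm (fun k => pairE (Hs D H S p₀ k p) (Ss D H S p₀ k p)) ≤ b N D H S p₀ ω₀ := by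
    rw [b, ← lintegral_const_mul' _ _ ENNReal.ofReal_ne_top,
      ← lintegral_const_mul' _ _ ENNReal.ofReal_ne_top]
    refine setLIntegral_mono' measurableSet_Ioi fun p hp => ?_
    rw [← mul_assoc, ← mul_assoc, FourierNorm.nrm_eq_enrm]
    exact mul_le_mul' (mul_expWeight_le hω₀ hω hmono hp) le_rfl
  have key := lintegral_expWeight_lt_top_of_volterra hhm h0 hloc hp₀ hB3pos hB3top hωpos
    (hs := fun p => N.enrm (fun k => pairE (Hs D H S p₀ k p) (Ss D H S p₀ k p)))
    (c := B1 N D p₀ + B4 N D p₀) ?_ ?_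
  · refine lt_of_eq_of_lt (setLIntegral_congr_fun_ae measurableSet_Ioi ?_)
      ((setLIntegral_le_lintegral (Ioi 0) _).trans_lt key)
    filter_upwards [hhae] with p hp hp0
    rw [hp hp0, expWeight]
  · filter_upwards [hineq, hhae] with p h1 h2 hp
    rw [← h2 (hp₀.trans hp), FourierNorm.nrm_eq_enrm]
    exact h1 hp
  · refine lt_of_le_of_lt ?_ hlt
    gcongr
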